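/- Let $n\ge 1$ and let $\mathbf B$ be a constant real $n\times n$ matrix. Let $\mathbb S_0^{n\times n}$ be the space of symmetric trace-free real $n\times n$ matrices, equip $\mathbb R^n\times\mathbb S_0^{n\times n}$ with the Euclidean norm $|(m,\mathbf U)|^2=|m|^2+\sum_{i,j}\mathbf U_{ij}^2$, and let $$\Lambda=\{(\bar m,\bar{\mathbf U})\in\mathbb R^n\times\mathbb S_0^{n\times n}:\ \text{there is } \eta\in\mathbb R^n\setminus\{0\}\text{ with }\bar m\cdot\eta=0\text{ and }\bar{\mathbf U}\eta=0\}.$$ Suppose that $w,w_1,w_2\in\mathbb R^n\times\mathbb S_0^{n\times n}$ and $\mu_1,\mu_2\ge 0$ satisfy $$w=\mu_1w_1+\mu_2w_2,\qquad \mu_1+\mu_2=1,\qquad w_2-w_1\in\Lambda.$$ Then for every open set $\mathcal O\subset\mathbb R^n$ of finite Lebesgue measure and every $\varepsilon>0$ there exists $\tilde w=(\tilde n,\tilde{\mathbf V})\in C_c^\infty(\mathcal O;\mathbb R^n\times\mathbb S_0^{n\times n})$ (extended by zero to $\mathbb R^n$) such that: (i) $\int_{\mathcal O}\tilde w(x)\,dx=0$,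 $\nabla\cdot\tilde n=0$ and $\nabla\cdot\tilde{\mathbf V}-\mathbf B\tilde n=0$, where $(\nabla\cdot\tilde{\mathbf V})_i=\sum_j\partial_j\tilde{\mathbf V}_{ij}$; (ii) $\operatorname{dist}(w+\tilde w(x),[w_1,w_2])<\varepsilon$ for all $x\in\mathcal O$, where $[w_1,w_2]$ is the closed segment from $w_1$ to $w_2$; (iii) there exist two disjoint open sets $\mathcal O_1,\mathcal O_2\subset\mathcal O$ such that, for $i=1,2$, $|w+\tilde w(x)-w_i|<\varepsilon$ for all $x\in\mathcal O_i$, and $\bigl||\mathcal O_i|-\mu_i|\mathcal O|\bigr|<\varepsilon$, where $|\cdot|$ of a set is its Lebesgue measure. -/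

import Mathlib

open MeasureTheory
open scoped ContDiff Matrix

/-- The matrix with entries `A (i, j)`. Elements of `EuclideanSpace ℝ (Fin n × Fin n)` are the real
`n × n` matrices with the Euclidean (Frobenius) norm `|A|² = ∑ᵢⱼ Aᵢⱼ²`. -/
def toMat {n : ℕ} (A : EuclideanSpace ℝ (Fin n × Fin n)) : Matrix (Fin n) (Fin n) ℝ :=
  Matrix.of fun i j => A (i, j)

/-- The space of symmetric trace-free real `n × n` matrices, with the Euclidean norm. -/
def SymTraceless (n : ℕ) : Submodule ℝ (EuclideanSpace ℝ (Fin n × Fin n)) where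
  carrier := {A | (toMat A)ᵀ = toMat A ∧ (toMat A).trace = 0}
  zero_mem' := ⟨rfl, by simp [toMat, Matrix.trace]⟩
  add_mem' := by
    rintro A B ⟨hA, hA'⟩ ⟨hB, hB'⟩
    have h : toMat (A + B) = toMat A + toMat B := rfl
    exact ⟨by rw [h, Matrix.transpose_add, hA, hB],
      by rw [h, Matrix.trace_add, hA', hB', add_zero]⟩
  smul_mem' := by
    rintro c A ⟨hA, hA'⟩
    have h : toMat (c • A) = c • toMat A := rfl
    exact ⟨by rw [h, Matrix.transpose_smul, hA],
      by rw [h, Matrix.trace_smul, hA', smul_zero]⟩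

/-- The state space of pairs (vector, symmetric trace-free matrix), with the Euclidean norm
`|(m, U)|² = |m|² + |U|²`. -/
abbrev State (n : ℕ) : Type :=
  WithLp 2 (EuclideanSpace ℝ (Fin n) × SymTraceless n)

/-- The vector component of a state. -/
def State.vec {n : ℕ} (w : State n) : EuclideanSpace ℝ (Fin n) := w.fst

/-- The matrix component of a state. -/
def State.mat {n : ℕ} (w : State n) : Matrix (Fin n) (Fin n) ℝ :=
  toMat (w.snd : EuclideanSpace ℝ (Fin n × Fin n))

/-- The wave cone: the states `(m, U)` such that `m · η = 0` and `U η = 0` for some nonzero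
vector `η`. -/
def waveCone (n : ℕ) : Set (State n) :=
  {w | ∃ η : EuclideanSpace ℝ (Fin n), η ≠ 0 ∧ inner ℝ w.vec η = 0 ∧ w.mat *ᵥ η.ofLp = 0}

/-- The partial derivative `∂ⱼ f` of a scalar function on `ℝⁿ`. -/
noncomputable def partialD {n : ℕ} (j : Fin n) (f : EuclideanSpace ℝ (Fin n) → ℝ)
    (x : EuclideanSpace ℝ (Fin n)) : ℝ :=
  fderiv ℝ f x (EuclideanSpace.single j 1)

/-- The divergence `∑ⱼ ∂ⱼ vⱼ` of a vector field. -/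
noncomputable def divVec {n : ℕ} (v : EuclideanSpace ℝ (Fin n) → EuclideanSpace ℝ (Fin n))
    (x : EuclideanSpace ℝ (Fin n)) : ℝ :=
  ∑ j, partialD j (fun y => v y j) x

/-- The row-wise divergence of a matrix field: its `i`-th component is `∑ⱼ ∂ⱼ Vᵢⱼ`. -/
noncomputable def divMat {n : ℕ} (V : EuclideanSpace ℝ (Fin n) → Matrix (Fin n) (Fin n) ℝ)
    (x : EuclideanSpace ℝ (Fin n)) : Fin n → ℝ :=
  fun i => ∑ j, partialD j (fun y => V y i j) x

/-! Write z = w₂ - w₁ and let η be a unit vector given by the cone condition. A 1-periodic,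
mean-zero profile h that is close to -μ₂ on a fraction μ₁ of each period and close to μ₁ on a
fraction μ₂ makes w + h(Nη·x) z oscillate between neighbourhoods of w₁ and w₂ in the right
proportions, since w - μ₂z = w₁ and w + μ₁z = w₂. It remains to localize this wave and solve the
equations exactly.

Both are done with potentials (`exists_potential_symbols`): homogeneous polynomial symbols p, q of
degree 5 and r of degree 4 with ξ·p = 0, qξ = 0, rξ = Bp, where q and r are symmetric and trace-free
and (p, q)(η) = z. For any test function φ, the pair (p(∂)φ, (q + r)(∂)φ) is then an exact solution
supported in supp φ, and it has zero mean because the symbols lack constant terms. With φ = N⁻⁵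
G(Nη·x) χ(x) and G⁽⁵⁾ = h, the leading part is h(Nη·x) χ z. Derivatives falling on χ cost a factor
1/N, and so does r, being of order 4; hence the term with B does not disturb the wave
(`exists_oscillating_solutions`).

The sets O₁, O₂ are where aᵢ(Nη·x) f(x) ≠ 0, for smooth periodic aᵢ supported in the plateaus of the
profile and a cutoff f. Weak convergence of oscillating functions to their mean
(`exists_integral_periodic_bound`) bounds both volumes from below; disjointness turns these into
upper bounds. -/

/-! ### Constant-coefficient differential operators on smooth functions -/

/-- The space of smooth real functions on `ℝⁿ`. -/
def smoothFn (n : ℕ) : Submodule ℝ (EuclideanSpace ℝ (Fin n) → ℝ) where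
  carrier := {f | ContDiff ℝ ∞ f}
  zero_mem' := show ContDiff ℝ ∞ fun _ => (0 : ℝ) from contDiff_zero_fun
  add_mem' := fun {f g} (hf : ContDiff ℝ ∞ f) (hg : ContDiff ℝ ∞ g) => hf.add hg
  smul_mem' := fun c f (hf : ContDiff ℝ ∞ f) => hf.const_smul c

theorem smoothFn.contDiff {n : ℕ} (f : smoothFn n) : ContDiff ℝ ∞ f.1 := f.2

theorem smoothFn.differentiable {n : ℕ} (f : smoothFn n) : Differentiable ℝ f.1 :=
  (smoothFn.contDiff f).differentiable (by simp)

theorem ContDiff.partialD {n : ℕ} {f : EuclideanSpace ℝ (Fin n) → ℝ} (hf : ContDiff ℝ ∞ f)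
    (j : Fin n) : ContDiff ℝ ∞ (partialD j f) :=
  (hf.fderiv_right (m := ∞) (by simp)).clm_apply contDiff_const

/-- The partial derivative as an endomorphism of the space of smooth functions. -/
noncomputable def pd {n : ℕ} (j : Fin n) : Module.End ℝ (smoothFn n) where
  toFun f := ⟨partialD j f.1, ContDiff.partialD f.2 j⟩
  map_add' f g := by
    ext x
    change fderiv ℝ (f.1 + g.1) x _ = fderiv ℝ f.1 x _ + fderiv ℝ g.1 x _
    rw [fderiv_add ((smoothFn.differentiable f) x) ((smoothFn.differentiable g) x)]; rfl
  map_smul' c f := by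
    ext x
    change fderiv ℝ (c • f.1) x _ = c • fderiv ℝ f.1 x _
    rw [fderiv_const_smul ((smoothFn.differentiable f) x)]; rfl

theorem pd_apply {n : ℕ} (j : Fin n) (f : smoothFn n) (x : EuclideanSpace ℝ (Fin n)) :
    (pd j f).1 x = fderiv ℝ f.1 x (EuclideanSpace.single j 1) := rfl

theorem pd_comm {n : ℕ} (i j : Fin n) : pd i * pd j = pd j * pd i := by
  have key : ∀ (i j : Fin n) (f : smoothFn n) (x : EuclideanSpace ℝ (Fin n)),
      (pd i (pd j f)).1 x = fderiv ℝ (fderiv ℝ f.1) x (EuclideanSpace.single i 1)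
        (EuclideanSpace.single j 1) := by
    intro i j f x
    have hd : DifferentiableAt ℝ (fderiv ℝ f.1) x :=
      (((smoothFn.contDiff f).fderiv_right (m := ∞) (by simp)).differentiable (by simp)) x
    rw [pd_apply]
    change fderiv ℝ (fun y => fderiv ℝ f.1 y (EuclideanSpace.single j 1)) x _ = _
    rw [fderiv_clm_apply hd (differentiableAt_const _)]
    simp
  ext f x
  change (pd i (pd j f)).1 x = (pd j (pd i f)).1 x
  rw [key, key]
  exact ((smoothFn.contDiff f).contDiffAt.isSymmSndFDerivAt
    (by simpa using WithTop.coe_le_coe.2 (le_top : (2 : ℕ∞) ≤ ⊤))) _ _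

open scoped IsMulCommutative in
/-- Evaluation of a polynomial at a commuting family in an algebra. -/
noncomputable def aevalOfComm {R A σ : Type*} [CommRing R] [Ring A] [Algebra R A] (a : σ → A)
    (h : ∀ i j, a i * a j = a j * a i) : MvPolynomial σ R →ₐ[R] A :=
  -- Polynomial evaluation needs a commutative target, so it takes place in the subalgebra generated
  -- by the family.
  haveI : IsMulCommutative (Algebra.adjoin R (Set.range a)) :=
    Algebra.isMulCommutative_adjoin R (by rintro _ ⟨i, rfl⟩ _ ⟨j, rfl⟩; exact h i j)
  (Algebra.adjoin R (Set.range a)).val.comp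
    (MvPolynomial.aeval fun j =>
      (⟨a j, Algebra.subset_adjoin ⟨j, rfl⟩⟩ : Algebra.adjoin R (Set.range a)))

theorem aevalOfComm_X {R A σ : Type*} [CommRing R] [Ring A] [Algebra R A] (a : σ → A)
    (h : ∀ i j, a i * a j = a j * a i) (j : σ) :
    aevalOfComm (R := R) a h (MvPolynomial.X j) = a j := by
  simp [aevalOfComm]

/-- The constant coefficient differential operator with a given symbol. -/
noncomputable def diffOp (n : ℕ) : MvPolynomial (Fin n) ℝ →ₐ[ℝ] Module.End ℝ (smoothFn n) :=
  aevalOfComm pd pd_comm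

theorem diffOp_X {n : ℕ} (j : Fin n) : diffOp n (MvPolynomial.X j) = pd j :=
  aevalOfComm_X _ _ j

theorem diffOp_C {n : ℕ} (c : ℝ) (f : smoothFn n) :
    diffOp n (MvPolynomial.C c) f = c • f := by
  have : diffOp n (MvPolynomial.C c) = algebraMap ℝ _ c := (diffOp n).commutes c
  rw [this]; rfl

theorem diffOp_mul_X {n : ℕ} (p : MvPolynomial (Fin n) ℝ) (j : Fin n) (f : smoothFn n) :
    diffOp n (p * MvPolynomial.X j) f = diffOp n p (pd j f) := by
  rw [map_mul, diffOp_X]; rfl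

theorem diffOp_X_mul {n : ℕ} (p : MvPolynomial (Fin n) ℝ) (j : Fin n) (f : smoothFn n) :
    diffOp n (MvPolynomial.X j * p) f = pd j (diffOp n p f) := by
  rw [map_mul, diffOp_X]; rfl

theorem tsupport_pd_subset {n : ℕ} (j : Fin n) (f : smoothFn n) :
    tsupport (pd j f).1 ⊆ tsupport f.1 :=
  tsupport_fderiv_apply_subset ℝ _

theorem tsupport_diffOp_subset {n : ℕ} (p : MvPolynomial (Fin n) ℝ) (f : smoothFn n) :
    tsupport (diffOp n p f).1 ⊆ tsupport f.1 := by
  induction p using MvPolynomial.induction_on generalizing f with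
  | C c =>
    rw [diffOp_C]
    exact closure_mono (Function.support_const_smul_subset c f.1)
  | add p q hp hq =>
    rw [map_add]
    exact (tsupport_add (diffOp n p f).1 (diffOp n q f).1).trans (Set.union_subset (hp f) (hq f))
  | mul_X p j hp =>
    rw [diffOp_mul_X]
    exact (hp _).trans (tsupport_pd_subset j f)

theorem hasCompactSupport_diffOp {n : ℕ} (p : MvPolynomial (Fin n) ℝ) {f : smoothFn n}
    (hf : HasCompactSupport f.1) : HasCompactSupport (diffOp n p f).1 :=
  hf.of_isClosed_subset (isClosed_tsupport _) (tsupport_diffOp_subset p f)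

theorem smoothFn.integrable {n : ℕ} (f : smoothFn n) (hf : HasCompactSupport f.1) :
    Integrable f.1 :=
  (smoothFn.contDiff f).continuous.integrable_of_hasCompactSupport hf

theorem hasCompactSupport_pd {n : ℕ} (j : Fin n) {f : smoothFn n} (hf : HasCompactSupport f.1) :
    HasCompactSupport (pd j f).1 :=
  hf.of_isClosed_subset (isClosed_tsupport _) (tsupport_pd_subset j f)

/-- Integration by parts against the constant function 1. -/
theorem integral_pd {n : ℕ} (j : Fin n) (f : smoothFn n) (hf : HasCompactSupport f.1) :
    ∫ x, (pd j f).1 x = 0 := by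
  have h := integral_mul_fderiv_eq_neg_fderiv_mul_of_integrable (μ := volume) (𝕜 := ℝ)
    (f := fun _ : EuclideanSpace ℝ (Fin n) => (1 : ℝ)) (g := f.1)
    (v := EuclideanSpace.single j 1) (by simp)
    (by simp only [one_mul]; exact smoothFn.integrable (pd j f) (hasCompactSupport_pd j hf))
    (by simpa using smoothFn.integrable f hf)
    (fun x _ => differentiableAt_const _) (fun x _ => smoothFn.differentiable f x)
  simp only [one_mul, fderiv_fun_const, Pi.zero_apply, zero_apply, zero_mul,
    integral_zero, neg_zero] at h
  exact h

/-- Every monomial of positive degree is a derivative of a compactly supported function and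
integrates to zero. -/
theorem integral_diffOp {n : ℕ} (p : MvPolynomial (Fin n) ℝ) (f : smoothFn n)
    (hf : HasCompactSupport f.1) :
    ∫ x, (diffOp n p f).1 x = MvPolynomial.constantCoeff p * ∫ x, f.1 x := by
  induction p using MvPolynomial.induction_on generalizing f with
  | C c =>
    rw [diffOp_C]
    simp [integral_const_mul]
  | add p q hp hq =>
    rw [map_add, map_add, add_mul, ← hp f hf, ← hq f hf]
    exact integral_add (smoothFn.integrable (diffOp n p f) (hasCompactSupport_diffOp p hf))
      (smoothFn.integrable (diffOp n q f) (hasCompactSupport_diffOp q hf))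
  | mul_X p j hp =>
    rw [diffOp_mul_X, hp _ (hasCompactSupport_pd j hf), integral_pd j f hf]
    simp

/-! ### Asymptotics of localized plane waves -/

/-- The localized plane wave `x ↦ G (N η · x) χ(x)`. -/
noncomputable def planeWave {n : ℕ} (η : EuclideanSpace ℝ (Fin n)) (G : ℝ → ℝ)
    (hG : ContDiff ℝ ∞ G) (χ : smoothFn n) (N : ℝ) : smoothFn n :=
  ⟨fun x => G (N * inner ℝ η x) * χ.1 x,
    (hG.comp (contDiff_const.mul (contDiff_const.inner ℝ contDiff_id))).mul χ.2⟩

theorem contDiff_deriv {G : ℝ → ℝ} (hG : ContDiff ℝ ∞ G) : ContDiff ℝ ∞ (deriv G) :=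
  (contDiff_infty_iff_deriv.1 hG).2

theorem pd_planeWave {n : ℕ} (η : EuclideanSpace ℝ (Fin n)) (G : ℝ → ℝ)
    (hG : ContDiff ℝ ∞ G) (χ : smoothFn n) (N : ℝ) (j : Fin n) :
    pd j (planeWave η G hG χ N) =
      (N * η j) • planeWave η (deriv G) (contDiff_deriv hG) χ N
        + planeWave η G hG (pd j χ) N := by
  ext x
  have h1 : HasFDerivAt (fun x : EuclideanSpace ℝ (Fin n) => N * inner ℝ η x)
      (N • innerSL ℝ η) x := (innerSL ℝ η).hasFDerivAt.const_mul N
  have h2 : HasDerivAt G (deriv G (N * inner ℝ η x)) (N * inner ℝ η x) :=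
    (hG.differentiable (by simp) _).hasDerivAt
  have h3 := h2.comp_hasFDerivAt x h1
  have h4 := h3.mul ((smoothFn.differentiable χ) x).hasFDerivAt
  rw [pd_apply]
  change fderiv ℝ (fun x => G (N * inner ℝ η x) * χ.1 x) x _ = _
  have h5 := h4.fderiv
  simp only [Function.comp_def] at h5
  have h6 : (fun x => G (N * inner ℝ η x) * χ.1 x) =
    ((fun x : EuclideanSpace ℝ (Fin n) => G (N * inner ℝ η x)) * χ.1) := rfl
  rw [h6, h5]
  simp only [add_apply, smul_apply, smul_eq_mul,
    innerSL_apply_apply, EuclideanSpace.inner_single_right]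
  change _ = (N * η j) * (deriv G (N * inner ℝ η x) * χ.1 x) + G (N * inner ℝ η x) * (pd j χ).1 x
  rw [pd_apply]
  simp
  ring

theorem periodic_deriv {G : ℝ → ℝ} {c : ℝ} (hG : Function.Periodic G c) :
    Function.Periodic (deriv G) c := by
  intro x
  rw [← deriv_comp_add_const]
  congr 1
  exact funext hG

theorem Function.Periodic.exists_bound {G : ℝ → ℝ} (hG : Continuous G)
    (hper : Function.Periodic G 1) : ∃ C, ∀ s, |G s| ≤ C := by
  obtain ⟨C, hC⟩ := (isCompact_Icc (a := (0 : ℝ)) (b := 1)).exists_bound_of_continuousOn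
    hG.continuousOn
  refine ⟨C, fun s => ?_⟩
  obtain ⟨y, hy, h⟩ := hper.exists_mem_Ico₀ one_pos s
  rw [h]
  exact hC y ⟨hy.1, hy.2.le⟩

theorem smoothFn.exists_bound {n : ℕ} (f : smoothFn n) (hf : HasCompactSupport f.1) :
    ∃ C, ∀ x, |f.1 x| ≤ C :=
  hf.exists_bound_of_continuous (smoothFn.contDiff f).continuous

theorem contDiff_iterate_deriv {G : ℝ → ℝ} (hG : ContDiff ℝ ∞ G) (k : ℕ) :
    ContDiff ℝ ∞ (deriv^[k] G) := by
  induction k with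
  | zero => exact hG
  | succ k ih => rw [Function.iterate_succ_apply']; exact contDiff_deriv ih

theorem periodic_iterate_deriv {G : ℝ → ℝ} {c : ℝ} (hG : Function.Periodic G c) (k : ℕ) :
    Function.Periodic (deriv^[k] G) c := by
  induction k with
  | zero => exact hG
  | succ k ih => rw [Function.iterate_succ_apply']; exact periodic_deriv ih

/-- The leading behaviour of iterated derivatives of a localized plane wave. -/
theorem diffOp_prod_planeWave_bound {n : ℕ} (η : EuclideanSpace ℝ (Fin n)) (t : Multiset (Fin n))
    (G : ℝ → ℝ) (hG : ContDiff ℝ ∞ G) (hper : Function.Periodic G 1) (χ : smoothFn n)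
    (hχ : HasCompactSupport χ.1) :
    ∃ C, ∀ N : ℝ, 1 ≤ N → ∀ x,
      N * |(diffOp n (t.map MvPolynomial.X).prod (planeWave η G hG χ N)).1 x
        - N ^ t.card * (t.map fun j => η j).prod * (deriv^[t.card] G (N * inner ℝ η x) * χ.1 x)|
        ≤ C * N ^ t.card := by
  -- One derivative yields Nηⱼ times the wave with profile G', plus the wave with cutoff ∂ⱼχ; hence
  -- G and χ must vary in the induction. The factor N on the left of the bound expresses an error of
  -- order N^(k-1) without a subtraction in the exponent, so it also makes sense for k = 0.
  induction t using Multiset.induction_on generalizing G χ with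
  | empty =>
    refine ⟨0, fun N hN x => ?_⟩
    simp [planeWave]
  | cons j t ih =>
    obtain ⟨C₁, h₁⟩ := ih (deriv G) (contDiff_deriv hG) (periodic_deriv hper) χ hχ
    obtain ⟨C₂, h₂⟩ := ih G hG hper (pd j χ) (hasCompactSupport_pd j hχ)
    obtain ⟨C₃, h₃⟩ := (periodic_iterate_deriv hper t.card).exists_bound
      (contDiff_iterate_deriv hG t.card).continuous
    obtain ⟨C₄, h₄⟩ := smoothFn.exists_bound (pd j χ) (hasCompactSupport_pd j hχ)
    refine ⟨|η j| * C₁ + (C₂ + |(t.map fun j => η j).prod| * (C₃ * C₄)), fun N hN x => ?_⟩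
    have hN0 : 0 ≤ N := by linarith
    rw [Multiset.map_cons, Multiset.prod_cons, mul_comm (MvPolynomial.X j), diffOp_mul_X,
      pd_planeWave, map_add, map_smul, Multiset.card_cons, Multiset.map_cons, Multiset.prod_cons,
      Function.iterate_succ_apply]
    change N * |(N * η j) * (diffOp n (t.map MvPolynomial.X).prod
        (planeWave η (deriv G) (contDiff_deriv hG) χ N)).1 x
      + (diffOp n (t.map MvPolynomial.X).prod (planeWave η G hG (pd j χ) N)).1 x - _| ≤ _
    specialize h₁ N hN x
    specialize h₂ N hN x
    have h₅ : |deriv^[t.card] G (N * inner ℝ η x) * (pd j χ).1 x| ≤ C₃ * C₄ := by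
      rw [abs_mul]
      exact mul_le_mul (h₃ _) (h₄ _) (abs_nonneg _) ((abs_nonneg _).trans (h₃ 0))
    set A := (diffOp n (t.map MvPolynomial.X).prod
        (planeWave η (deriv G) (contDiff_deriv hG) χ N)).1 x
    set A' := N ^ t.card * (t.map fun j => η j).prod *
      (deriv^[t.card] (deriv G) (N * inner ℝ η x) * χ.1 x) with hA'
    set D := (diffOp n (t.map MvPolynomial.X).prod (planeWave η G hG (pd j χ) N)).1 x
    set P := (t.map fun j => η j).prod
    set D' := deriv^[t.card] G (N * inner ℝ η x) * (pd j χ).1 x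
    -- The leading part of the wave with cutoff ∂ⱼχ has one power of N too few, so it joins the
    -- error.
    have e : N * η j * A + D - N ^ (t.card + 1) * (η j * P) *
        (deriv^[t.card] (deriv G) (N * inner ℝ η x) * χ.1 x)
        = N * η j * (A - A') + (D - N ^ t.card * P * D') + N ^ t.card * P * D' := by
      rw [hA']; ring
    rw [e]
    have hNt : (0 : ℝ) ≤ N ^ t.card := pow_nonneg hN0 _
    have b1 : |N * η j * (A - A')| = N * (|η j| * |A - A'|) := by
      rw [abs_mul, abs_mul, abs_of_nonneg hN0]; ring
    have b2 : |N ^ t.card * P * D'| = N ^ t.card * (|P| * |D'|) := by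
      rw [abs_mul, abs_mul, abs_of_nonneg hNt]; ring
    have b3 := abs_add_three (N * η j * (A - A')) (D - N ^ t.card * P * D') (N ^ t.card * P * D')
    calc _ ≤ N * (N * (|η j| * |A - A'|) + |D - N ^ t.card * P * D'|
          + N ^ t.card * (|P| * |D'|)) := by
          rw [← b1, ← b2]; exact mul_le_mul_of_nonneg_left b3 hN0
      _ = N * |η j| * (N * |A - A'|) + N * |D - N ^ t.card * P * D'|
          + N * N ^ t.card * (|P| * |D'|) := by ring
      _ ≤ N * |η j| * (C₁ * N ^ t.card) + N * (C₂ * N ^ t.card)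
          + N * N ^ t.card * (|P| * (C₃ * C₄)) := by
          gcongr
          exact (le_mul_of_one_le_left (abs_nonneg _) hN).trans h₂
      _ = _ := by ring

/-- By homogeneity all monomials produce the same power N^k, so the leading coefficients add up to
the symbol evaluated at η. -/
theorem diffOp_planeWave_bound {n : ℕ} (η : EuclideanSpace ℝ (Fin n)) {k : ℕ}
    (p : MvPolynomial (Fin n) ℝ) (hp : p.IsHomogeneous k)
    (G : ℝ → ℝ) (hG : ContDiff ℝ ∞ G) (hper : Function.Periodic G 1) (χ : smoothFn n)
    (hχ : HasCompactSupport χ.1) :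
    ∃ C, 0 ≤ C ∧ ∀ N : ℝ, 1 ≤ N → ∀ x,
      N * |(diffOp n p (planeWave η G hG χ N)).1 x
        - N ^ k * MvPolynomial.eval (fun j => η j) p *
          (deriv^[k] G (N * inner ℝ η x) * χ.1 x)| ≤ C * N ^ k := by
  have key : ∀ s ∈ p.support, ∃ C, ∀ N : ℝ, 1 ≤ N → ∀ x,
      N * |(diffOp n (MvPolynomial.monomial s (p.coeff s)) (planeWave η G hG χ N)).1 x
        - N ^ k * MvPolynomial.eval (fun j => η j) (MvPolynomial.monomial s (p.coeff s)) *
          (deriv^[k] G (N * inner ℝ η x) * χ.1 x)| ≤ C * N ^ k := by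
    intro s hs
    obtain ⟨C, hC⟩ := diffOp_prod_planeWave_bound η (Finsupp.toMultiset s) G hG hper χ hχ
    have hcard : (Finsupp.toMultiset s).card = k := by
      have := hp (MvPolynomial.mem_support_iff.1 hs)
      rw [Finsupp.card_toMultiset, ← this]
      simp [Finsupp.weight_apply, Finsupp.sum]
    have hmon : MvPolynomial.monomial s (p.coeff s) = MvPolynomial.C (p.coeff s) *
        ((Finsupp.toMultiset s).map MvPolynomial.X).prod := by
      rw [MvPolynomial.monomial_eq, Finsupp.toMultiset_map, Finsupp.prod_toMultiset,
        Finsupp.prod_mapDomain_index (by simp) (by simp [pow_add])]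
    have hev : MvPolynomial.eval (fun j => η j)
        ((Finsupp.toMultiset s).map MvPolynomial.X).prod
        = ((Finsupp.toMultiset s).map fun j => η j).prod := by
      rw [map_multiset_prod, Multiset.map_map]
      simp
    rw [hcard] at hC
    refine ⟨|p.coeff s| * C, fun N hN x => ?_⟩
    rw [hmon, map_mul (MvPolynomial.eval _), hev, MvPolynomial.eval_C, map_mul (diffOp n)]
    change N * |(diffOp n (MvPolynomial.C (p.coeff s)) (diffOp n _ _)).1 x - _| ≤ _
    rw [diffOp_C]
    change N * |p.coeff s * (diffOp n _ _).1 x - _| ≤ _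
    have := mul_le_mul_of_nonneg_left (hC N hN x) (abs_nonneg (p.coeff s))
    rw [← mul_assoc |_| C, mul_left_comm, ← abs_mul] at this
    refine le_trans (le_of_eq ?_) this
    ring_nf
  choose! C hC using key
  refine ⟨|∑ s ∈ p.support, C s|, abs_nonneg _, fun N hN x => ?_⟩
  have hN0 : 0 ≤ N := by linarith
  refine le_trans ?_ (mul_le_mul_of_nonneg_right (le_abs_self _) (pow_nonneg hN0 k))
  have e : (diffOp n p (planeWave η G hG χ N)).1 x
        - N ^ k * MvPolynomial.eval (fun j => η j) p *
          (deriv^[k] G (N * inner ℝ η x) * χ.1 x) = ∑ s ∈ p.support,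
      ((diffOp n (MvPolynomial.monomial s (p.coeff s)) (planeWave η G hG χ N)).1 x
        - N ^ k * MvPolynomial.eval (fun j => η j) (MvPolynomial.monomial s (p.coeff s)) *
          (deriv^[k] G (N * inner ℝ η x) * χ.1 x)) := by
    rw [Finset.sum_sub_distrib, ← Finset.sum_mul, ← Finset.mul_sum, ← map_sum,
      MvPolynomial.support_sum_monomial_coeff]
    congr 1
    conv_lhs => rw [← MvPolynomial.support_sum_monomial_coeff p, map_sum]
    simp
  rw [e, Finset.sum_mul]
  refine (mul_le_mul_of_nonneg_left (Finset.abs_sum_le_sum_abs _ _) hN0).trans ?_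
  rw [Finset.mul_sum]
  exact Finset.sum_le_sum fun s hs => hC s hs N hN x

/-! ### Algebra of the potential symbols -/

section Algebra

variable {n : ℕ} {R : Type*} [CommRing R]

/-- The matrix `|ξ|² I - ξ ξᵀ`. -/
def perpMat (ξ : Fin n → R) : Matrix (Fin n) (Fin n) R :=
  (ξ ⬝ᵥ ξ) • (1 : Matrix (Fin n) (Fin n) R) - Matrix.vecMulVec ξ ξ

theorem perpMat_mulVec (ξ v : Fin n → R) : perpMat ξ *ᵥ v = (ξ ⬝ᵥ ξ) • v - (ξ ⬝ᵥ v) • ξ := by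
  rw [perpMat, Matrix.sub_mulVec, Matrix.smul_mulVec, Matrix.one_mulVec, Matrix.vecMulVec_mulVec]
  simp

theorem perpMat_mulVec_self (ξ : Fin n → R) : perpMat ξ *ᵥ ξ = 0 := by
  rw [perpMat_mulVec, sub_self]

theorem perpMat_transpose (ξ : Fin n → R) : (perpMat ξ)ᵀ = perpMat ξ := by
  simp [perpMat, Matrix.transpose_vecMulVec]

theorem perpMat_mul_self (ξ : Fin n → R) : perpMat ξ * perpMat ξ = (ξ ⬝ᵥ ξ) • perpMat ξ := by
  have h : ξ ᵥ* perpMat ξ = 0 := by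
    rw [← Matrix.mulVec_transpose, perpMat_transpose, perpMat_mulVec_self]
  have h' : perpMat ξ * perpMat ξ =
      ((ξ ⬝ᵥ ξ) • (1 : Matrix (Fin n) (Fin n) R) - Matrix.vecMulVec ξ ξ) * perpMat ξ := rfl
  rw [h', Matrix.sub_mul, Matrix.smul_mul, Matrix.one_mul, Matrix.vecMulVec_mul, h]
  simp

theorem perpMat_trace (ξ : Fin n → R) : (perpMat ξ).trace = (n - 1) * (ξ ⬝ᵥ ξ) := by
  simp [perpMat, Matrix.trace_vecMulVec]
  ring

/-- The symbol of a potential operator for symmetric trace-free divergence-free matrix fields;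
`κ` is meant to be the inverse of `n - 1`. -/
def divFreeSymbol (κ : R) (U : Matrix (Fin n) (Fin n) R) (ξ : Fin n → R) :
    Matrix (Fin n) (Fin n) R :=
  perpMat ξ * U * perpMat ξ - (κ * (U * perpMat ξ).trace) • perpMat ξ

theorem divFreeSymbol_mulVec (κ : R) (U : Matrix (Fin n) (Fin n) R) (ξ : Fin n → R) :
    divFreeSymbol κ U ξ *ᵥ ξ = 0 := by
  rw [divFreeSymbol, Matrix.sub_mulVec, ← Matrix.mulVec_mulVec, Matrix.smul_mulVec,
    perpMat_mulVec_self]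
  simp

theorem divFreeSymbol_transpose (κ : R) {U : Matrix (Fin n) (Fin n) R} (hU : Uᵀ = U)
    (ξ : Fin n → R) : (divFreeSymbol κ U ξ)ᵀ = divFreeSymbol κ U ξ := by
  simp [divFreeSymbol, Matrix.transpose_mul, perpMat_transpose, hU, Matrix.mul_assoc]

theorem divFreeSymbol_trace {κ : R} (hκ : κ * (n - 1) = 1) (U : Matrix (Fin n) (Fin n) R)
    (ξ : Fin n → R) : (divFreeSymbol κ U ξ).trace = 0 := by
  rw [divFreeSymbol, Matrix.trace_sub, Matrix.trace_smul, perpMat_trace, Matrix.mul_assoc,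
    Matrix.trace_mul_comm, Matrix.mul_assoc, perpMat_mul_self, Matrix.mul_smul, Matrix.trace_smul,
    smul_eq_mul, smul_eq_mul]
  linear_combination (-(U * perpMat ξ).trace * (ξ ⬝ᵥ ξ)) * hκ

/-- At a unit vector P is the orthogonal projection onto its complement, so UP = PU = U, and the
trace correction vanishes with tr U. -/
theorem divFreeSymbol_of_mulVec_eq_zero (κ : R) {U : Matrix (Fin n) (Fin n) R} (hU : Uᵀ = U)
    (htr : U.trace = 0) {ξ : Fin n → R} (hξ : ξ ⬝ᵥ ξ = 1) (hUξ : U *ᵥ ξ = 0) :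
    divFreeSymbol κ U ξ = U := by
  have h1 : U * perpMat ξ = U := by
    rw [perpMat, hξ, Matrix.mul_sub, Matrix.mul_vecMulVec, hUξ]
    simp
  have h2 : perpMat ξ * U = U := by
    have := congrArg Matrix.transpose h1
    rwa [Matrix.transpose_mul, hU, perpMat_transpose] at this
  rw [divFreeSymbol, h2, h1, htr]
  simp

/-- The symbol of the trace-free symmetric gradient; `c` is meant to be `2 / n`. -/
def symGradSymbol (c : R) (g ξ : Fin n → R) : Matrix (Fin n) (Fin n) R :=
  Matrix.vecMulVec ξ g + Matrix.vecMulVec g ξ - (c * (ξ ⬝ᵥ g)) • (1 : Matrix (Fin n) (Fin n) R)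

theorem symGradSymbol_transpose (c : R) (g ξ : Fin n → R) :
    (symGradSymbol c g ξ)ᵀ = symGradSymbol c g ξ := by
  simp [symGradSymbol, Matrix.transpose_vecMulVec, add_comm]

theorem symGradSymbol_trace {c : R} (hc : c * n = 2) (g ξ : Fin n → R) :
    (symGradSymbol c g ξ).trace = 0 := by
  simp only [symGradSymbol, Matrix.trace_sub, Matrix.trace_add, Matrix.trace_vecMulVec,
    Matrix.trace_smul, Matrix.trace_one, Fintype.card_fin, smul_eq_mul, dotProduct_comm g ξ]
  linear_combination (-(ξ ⬝ᵥ g)) * hc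

/-- Applied to ξ, the symbol gives |ξ|²g + (1 - c)(ξ·g)ξ. With the chosen g, the multiples of ξ
cancel exactly when d = (1 - c)(1 - d), which is `hd`. This inverts the divergence up to the factor
|ξ|⁴. -/
theorem symGradSymbol_mulVec {c d : R} (hd : d * (2 - c) = 1 - c) (h ξ : Fin n → R) :
    symGradSymbol c ((ξ ⬝ᵥ ξ) • h - (d * (ξ ⬝ᵥ h)) • ξ) ξ *ᵥ ξ = (ξ ⬝ᵥ ξ) ^ 2 • h := by
  ext i
  simp only [symGradSymbol, Matrix.sub_mulVec, Matrix.add_mulVec, Matrix.smul_mulVec,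
    Matrix.one_mulVec, Matrix.vecMulVec_mulVec, sub_dotProduct, dotProduct_sub, smul_dotProduct,
    dotProduct_smul, Pi.sub_apply, Pi.add_apply, Pi.smul_apply, smul_eq_mul, op_smul_eq_smul,
    dotProduct_comm h ξ]
  linear_combination (-(ξ ⬝ᵥ h) * (ξ ⬝ᵥ ξ) * ξ i) * hd

end Algebra

/-! ### Homogeneity and construction of the potential symbols -/

section Homogeneous

open MvPolynomial

variable {n : ℕ} {σ : Type*}

theorem isHomogeneous_dotProduct {a b : ℕ} {v w : Fin n → MvPolynomial σ ℝ}
    (hv : ∀ i, (v i).IsHomogeneous a) (hw : ∀ i, (w i).IsHomogeneous b) :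
    (v ⬝ᵥ w).IsHomogeneous (a + b) :=
  IsHomogeneous.sum _ _ _ fun i _ => (hv i).mul (hw i)

theorem isHomogeneous_matrix_mul {a b : ℕ} {M N : Matrix (Fin n) (Fin n) (MvPolynomial σ ℝ)}
    (hM : ∀ i j, (M i j).IsHomogeneous a) (hN : ∀ i j, (N i j).IsHomogeneous b) (i j : Fin n) :
    ((M * N) i j).IsHomogeneous (a + b) :=
  IsHomogeneous.sum _ _ _ fun k _ => (hM i k).mul (hN k j)

theorem isHomogeneous_trace {a : ℕ} {M : Matrix (Fin n) (Fin n) (MvPolynomial σ ℝ)}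
    (hM : ∀ i j, (M i j).IsHomogeneous a) : M.trace.IsHomogeneous a :=
  IsHomogeneous.sum _ _ _ fun k _ => hM k k

theorem isHomogeneous_matrix_one (i j : Fin n) :
    ((1 : Matrix (Fin n) (Fin n) (MvPolynomial σ ℝ)) i j).IsHomogeneous 0 := by
  rw [Matrix.one_apply]
  split_ifs
  · exact isHomogeneous_one _ _
  · exact isHomogeneous_zero _ _ _

theorem isHomogeneous_perpMat (i j : Fin n) :
    (perpMat (X : Fin n → MvPolynomial (Fin n) ℝ) i j).IsHomogeneous 2 :=
  ((isHomogeneous_dotProduct (isHomogeneous_X ℝ) (isHomogeneous_X ℝ)).mul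
    (isHomogeneous_matrix_one i j)).sub ((isHomogeneous_X ℝ i).mul (isHomogeneous_X ℝ j))

theorem isHomogeneous_divFreeSymbol (κ : ℝ) (U : Matrix (Fin n) (Fin n) ℝ) (i j : Fin n) :
    (divFreeSymbol (C κ) (U.map C) (X : Fin n → MvPolynomial (Fin n) ℝ) i j).IsHomogeneous 4 := by
  have hU : ∀ i j, (U.map C i j : MvPolynomial (Fin n) ℝ).IsHomogeneous 0 :=
    fun i j => isHomogeneous_C _ _
  exact (isHomogeneous_matrix_mul (isHomogeneous_matrix_mul isHomogeneous_perpMat hU)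
    isHomogeneous_perpMat i j).sub
    ((((isHomogeneous_C _ κ).mul (isHomogeneous_trace (isHomogeneous_matrix_mul hU
      isHomogeneous_perpMat))).mul (isHomogeneous_perpMat i j)))

theorem isHomogeneous_symGradSymbol (c : ℝ) {a : ℕ} {g : Fin n → MvPolynomial (Fin n) ℝ}
    (hg : ∀ i, (g i).IsHomogeneous a) (i j : Fin n) :
    (symGradSymbol (C c) g X i j).IsHomogeneous (a + 1) := by
  have h := (((isHomogeneous_X ℝ i).mul (hg j)).add (by
    rw [add_comm]; exact (hg i).mul (isHomogeneous_X ℝ j))).sub (by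
    simpa using (((isHomogeneous_C _ c).mul (isHomogeneous_dotProduct (isHomogeneous_X ℝ) hg)).mul
      (isHomogeneous_matrix_one i j)))
  rw [add_comm]
  exact h

end Homogeneous

open MvPolynomial in
/-- Symbols of potential operators for the system `∇ · m = 0`, `∇ · V = B m`, with prescribed
principal values at a unit vector. -/
theorem exists_potential_symbols {n : ℕ} (B : Matrix (Fin n) (Fin n) ℝ) (η m : Fin n → ℝ)
    (U : Matrix (Fin n) (Fin n) ℝ) (hη : η ⬝ᵥ η = 1) (hU : Uᵀ = U) (htr : U.trace = 0)
    (hm : m ⬝ᵥ η = 0) (hUη : U *ᵥ η = 0) :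
    ∃ (p : Fin n → MvPolynomial (Fin n) ℝ)
      (q r : Matrix (Fin n) (Fin n) (MvPolynomial (Fin n) ℝ)),
      (∀ i, (p i).IsHomogeneous 5) ∧ (∀ i j, (q i j).IsHomogeneous 5) ∧
      (∀ i j, (r i j).IsHomogeneous 4) ∧ X ⬝ᵥ p = 0 ∧ q *ᵥ X = 0 ∧ r *ᵥ X = B.map C *ᵥ p ∧
      qᵀ = q ∧ rᵀ = r ∧ q.trace = 0 ∧ r.trace = 0 ∧
      (∀ i, eval η (p i) = m i) ∧ (∀ i j, eval η (q i j) = U i j) := by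
  -- The constant κ = 1/(n - 1) needs n ≥ 2. For n = 1 the hypotheses force m = 0 and U = 0, so zero
  -- symbols suffice.
  rcases Nat.lt_or_ge n 2 with hn | hn
  · have hn1 : n ≠ 0 := by rintro rfl; simp at hη
    obtain rfl : n = 1 := by omega
    have hη0 : η 0 ≠ 0 := by rintro h; simp [dotProduct, h] at hη
    have hm0 : m 0 = 0 := by simpa [dotProduct, hη0] using hm
    have hU0 : U 0 0 = 0 := by simpa [Matrix.trace] using htr
    refine ⟨0, 0, 0, fun _ => isHomogeneous_zero _ _ _, fun _ _ => isHomogeneous_zero _ _ _,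
      fun _ _ => isHomogeneous_zero _ _ _, ?_, ?_, ?_, ?_, ?_, ?_, ?_, ?_, ?_⟩
    · simp
    · simp
    · simp
    · simp
    · simp
    · simp
    · simp
    · intro i
      rw [Fin.fin_one_eq_zero i, hm0]
      simp
    · intro i j
      rw [Fin.fin_one_eq_zero i, Fin.fin_one_eq_zero j, hU0]
      simp
  have hn' : (2 : ℝ) ≤ n := by exact_mod_cast hn
  set ξ : Fin n → MvPolynomial (Fin n) ℝ := X with hξ
  set κ : ℝ := (n - 1 : ℝ)⁻¹
  have hκ : κ * (n - 1) = 1 := inv_mul_cancel₀ (by linarith)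
  set c : ℝ := 2 / n with hc_def
  have hc : c * n = 2 := div_mul_cancel₀ _ (by linarith)
  have hc2 : 2 - c ≠ 0 := by
    have : c ≤ 1 := by rw [hc_def, div_le_one (by linarith)]; exact hn'
    linarith
  set d : ℝ := (1 - c) / (2 - c)
  have hd : d * (2 - c) = 1 - c := div_mul_cancel₀ _ hc2
  set η' : Fin n → MvPolynomial (Fin n) ℝ := fun i => C (η i)
  set m' : Fin n → MvPolynomial (Fin n) ℝ := fun i => C (m i)
  have hη'h : ∀ i, (η' i).IsHomogeneous 0 := fun i => isHomogeneous_C _ _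
  have hm'h : ∀ i, (m' i).IsHomogeneous 0 := fun i => isHomogeneous_C _ _
  have hξh : ∀ i, (ξ i).IsHomogeneous 1 := isHomogeneous_X ℝ
  -- Orthogonal to ξ identically, and equal to m at ξ = η because m·η = 0.
  set v := (η' ⬝ᵥ ξ) • m' - (m' ⬝ᵥ ξ) • η'
  have hvh : ∀ i, (v i).IsHomogeneous 1 := fun i => by
    have := ((isHomogeneous_dotProduct hη'h hξh).mul (hm'h i)).sub
      ((isHomogeneous_dotProduct hm'h hξh).mul (hη'h i))
    exact this
  set h := B.map C *ᵥ v
  have hhh : ∀ i, (h i).IsHomogeneous 1 := fun i => by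
    have := isHomogeneous_dotProduct (v := (B.map C : Matrix _ _ (MvPolynomial (Fin n) ℝ)) i)
      (a := 0) (fun j => isHomogeneous_C _ _) hvh
    exact this
  have hsh : (ξ ⬝ᵥ ξ).IsHomogeneous 2 := isHomogeneous_dotProduct hξh hξh
  set g := (ξ ⬝ᵥ ξ) • h - (C d * (ξ ⬝ᵥ h)) • ξ
  have hgh : ∀ i, (g i).IsHomogeneous 3 := fun i => by
    have := (hsh.mul (hhh i)).sub ((((isHomogeneous_C _ d).mul
      (isHomogeneous_dotProduct hξh hhh)).mul (hξh i)))
    exact this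
  have evξ : ∀ i, eval η (ξ i) = η i := fun i => eval_X _
  have evs : eval η (ξ ⬝ᵥ ξ) = 1 := by
    rw [← hη]; simp [dotProduct, hξ]
  have evl : eval η (η' ⬝ᵥ ξ) = 1 := by
    rw [← hη]; simp [dotProduct, hξ, η']
  have evm : eval η (m' ⬝ᵥ ξ) = 0 := by
    rw [← hm]; simp [dotProduct, hξ, m']
  -- The factor |ξ|⁴ on v is what makes rξ = Bp solvable by polynomials. The factor η·ξ, equal to 1
  -- at η, raises the degree of q from 4 to 5 to match p.
  refine ⟨(ξ ⬝ᵥ ξ) ^ 2 • v, (η' ⬝ᵥ ξ) • divFreeSymbol (C κ) (U.map C) ξ,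
    symGradSymbol (C c) g ξ, ?_, ?_, ?_, ?_, ?_, ?_, ?_, ?_, ?_, ?_, ?_, ?_⟩
  · exact fun i => (hsh.pow 2).mul (hvh i)
  · intro i j
    exact (isHomogeneous_dotProduct hη'h hξh).mul (isHomogeneous_divFreeSymbol κ U i j)
  · exact isHomogeneous_symGradSymbol c hgh
  · rw [dotProduct_smul, dotProduct_sub, dotProduct_smul, dotProduct_smul, dotProduct_comm ξ m',
      dotProduct_comm ξ η', smul_eq_mul, smul_eq_mul]
    ring
  · rw [Matrix.smul_mulVec, divFreeSymbol_mulVec, smul_zero]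
  · rw [symGradSymbol_mulVec (by rw [← map_ofNat C 2, ← map_sub, ← map_mul, hd]; simp),
      Matrix.mulVec_smul]
  · rw [Matrix.transpose_smul, divFreeSymbol_transpose]
    rw [← Matrix.transpose_map, hU]
  · exact symGradSymbol_transpose _ _ _
  · rw [Matrix.trace_smul, divFreeSymbol_trace, smul_zero]
    rw [← map_natCast C, ← map_one C, ← map_sub, ← map_mul, hκ]
  · apply symGradSymbol_trace
    rw [← map_natCast C, ← map_mul, hc]
    exact map_ofNat C 2
  · intro i
    simp [v, evs, evl, evm, m']
  · intro i j
    have h1 : (divFreeSymbol (C κ) (U.map C) ξ).map (eval η) = divFreeSymbol κ U η := by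
      have hP : (perpMat ξ).map (eval η) = perpMat η := by
        ext i j
        simp [perpMat, evs, hη, Matrix.one_apply, Matrix.vecMulVec_apply, evξ, apply_ite]
      have hUm : (U.map C : Matrix _ _ (MvPolynomial (Fin n) ℝ)).map (eval η) = U := by
        ext i j; simp
      have ht : eval η ((U.map C) * perpMat ξ).trace = (U * perpMat η).trace := by
        rw [← hP]
        conv_rhs => rw [← hUm]
        rw [← Matrix.map_mul, Matrix.trace, Matrix.trace, map_sum]
        rfl
      rw [divFreeSymbol, divFreeSymbol, ← hP]
      conv_rhs => rw [← hUm]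
      rw [← Matrix.map_mul, ← Matrix.map_mul]
      ext i j
      simp only [Matrix.map_apply, Matrix.sub_apply, Matrix.smul_apply, smul_eq_mul, map_sub,
        map_mul, eval_C]
      rw [ht, hP, hUm]
    have h2 := congrFun (congrFun (h1.trans
      (divFreeSymbol_of_mulVec_eq_zero κ hU htr hη hUη)) i) j
    rw [Matrix.smul_apply, smul_eq_mul, map_mul, evl, one_mul]
    exact h2

/-! ### Periodic primitives and the step profile -/

theorem Function.Periodic.exists_primitive {H : ℝ → ℝ} (hH : ContDiff ℝ ∞ H)
    (hper : Function.Periodic H 1) (h0 : ∫ s in (0 : ℝ)..1, H s = 0) :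
    ∃ G : ℝ → ℝ, ContDiff ℝ ∞ G ∧ Function.Periodic G 1 ∧ ∫ s in (0 : ℝ)..1, G s = 0 ∧
      deriv G = H := by
  set G₀ : ℝ → ℝ := fun x => ∫ s in (0 : ℝ)..x, H s
  have hd : ∀ x, HasDerivAt G₀ (H x) x := fun x =>
    intervalIntegral.integral_hasDerivAt_right (hH.continuous.intervalIntegrable _ _)
      hH.continuous.stronglyMeasurable.stronglyMeasurableAtFilter hH.continuous.continuousAt
  have hd0 : deriv G₀ = H := funext fun x => (hd x).deriv
  have hG₀ : ContDiff ℝ ∞ G₀ :=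
    contDiff_infty_iff_deriv.2 ⟨fun x => (hd x).differentiableAt, by rw [hd0]; exact hH⟩
  have hp₀ : Function.Periodic G₀ 1 := fun x => by
    have h1 := hper.intervalIntegral_add_eq x 0
    have h2 := intervalIntegral.integral_add_adjacent_intervals
      (hH.continuous.intervalIntegrable (μ := volume) 0 x)
      (hH.continuous.intervalIntegrable x (x + 1))
    simp only [G₀]
    rw [← h2, h1, zero_add, h0, add_zero]
  -- Subtracting the mean allows the construction to be iterated.
  refine ⟨fun x => G₀ x - ∫ s in (0 : ℝ)..1, G₀ s, hG₀.sub contDiff_const, fun x => ?_, ?_, ?_⟩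
  · simp only [hp₀ x]
  · rw [intervalIntegral.integral_sub (hG₀.continuous.intervalIntegrable _ _) (by simp)]
    simp
  · funext x
    rw [deriv_sub_const, hd0]

theorem Function.Periodic.exists_iterate_primitive (k : ℕ) {H : ℝ → ℝ} (hH : ContDiff ℝ ∞ H)
    (hper : Function.Periodic H 1) (h0 : ∫ s in (0 : ℝ)..1, H s = 0) :
    ∃ G : ℝ → ℝ, ContDiff ℝ ∞ G ∧ Function.Periodic G 1 ∧ deriv^[k] G = H := by
  induction k generalizing H with
  | zero => exact ⟨H, hH, hper, rfl⟩
  | succ k ih =>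
    obtain ⟨G₁, h1, h2, h3, h4⟩ := hper.exists_primitive hH h0
    obtain ⟨G, g1, g2, g3⟩ := ih h1 h2 h3
    exact ⟨G, g1, g2, by rw [Function.iterate_succ_apply', g3, h4]⟩

/-- Dominated convergence: the integrand is eventually 1 where g > 0, and is 0 elsewhere because b ≥
0. -/
theorem tendsto_integral_smoothTransition {g : ℝ → ℝ} (hg : Continuous g) {b : ℝ} (hb : 0 ≤ b) :
    Filter.Tendsto (fun K : ℕ => ∫ s in (0 : ℝ)..1, Real.smoothTransition (K * g s - b))
      Filter.atTop (nhds (volume.real (Set.Ioc 0 1 ∩ {s | 0 < g s}))) := by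
  have hmeas : MeasurableSet {s | 0 < g s} := (isOpen_lt continuous_const hg).measurableSet
  have hlim : volume.real (Set.Ioc 0 1 ∩ {s | 0 < g s}) =
      ∫ s in (0 : ℝ)..1, {s | 0 < g s}.indicator (fun _ => (1 : ℝ)) s := by
    rw [intervalIntegral.integral_of_le zero_le_one, integral_indicator hmeas,
      Measure.restrict_restrict hmeas]
    simp [Set.inter_comm]
  rw [hlim]
  apply intervalIntegral.tendsto_integral_filter_of_dominated_convergence (fun _ => (1 : ℝ))
  · refine Filter.Eventually.of_forall fun K => Continuous.aestronglyMeasurable ?_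
    exact Real.smoothTransition.continuous.comp ((continuous_const.mul hg).sub continuous_const)
  · refine Filter.Eventually.of_forall fun K => Filter.Eventually.of_forall fun s _ => ?_
    rw [Real.norm_of_nonneg (Real.smoothTransition.nonneg _)]
    exact Real.smoothTransition.le_one _
  · simp
  · refine Filter.Eventually.of_forall fun s _ => ?_
    by_cases hs : 0 < g s
    · have h1 : Filter.Tendsto (fun K : ℕ => (K : ℝ) * g s - b) Filter.atTop Filter.atTop :=
        Filter.tendsto_atTop_add_const_right _ _
          (tendsto_natCast_atTop_atTop.atTop_mul_const hs)
      rw [Set.indicator_of_mem (by exact hs)]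
      refine tendsto_const_nhds.congr' ?_
      filter_upwards [h1.eventually_ge_atTop 1] with K hK
      exact (Real.smoothTransition.one_of_one_le hK).symm
    · rw [Set.indicator_of_notMem (by exact hs)]
      refine tendsto_const_nhds.congr fun K => ?_
      rw [Real.smoothTransition.zero_of_nonpos]
      have : (K : ℝ) * g s ≤ 0 :=
        mul_nonpos_of_nonneg_of_nonpos (Nat.cast_nonneg _) (not_lt.1 hs)
      linarith

theorem cos_lt_cos_iff_lt_abs {μ : ℝ} (h0 : 0 ≤ μ) (h1 : μ ≤ 1) {s : ℝ} (hs : |s| ≤ 1) :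
    Real.cos (Real.pi * μ) < Real.cos (Real.pi * s) ↔ |s| < μ := by
  have hp := Real.pi_pos
  rw [← Real.cos_abs (Real.pi * s), abs_mul, abs_of_pos hp,
    Real.strictAntiOn_cos.lt_iff_gt ⟨by positivity, by nlinarith⟩
      ⟨by positivity, by nlinarith⟩]
  exact mul_lt_mul_iff_right₀ hp

theorem volume_cos_superlevel {μ : ℝ} (h0 : 0 ≤ μ) (h1 : μ ≤ 1) :
    volume.real (Set.Ioc 0 1 ∩
      {s | 0 < Real.cos (Real.pi * (2 * s - 1)) - Real.cos (Real.pi * μ)}) = μ := by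
  have : Set.Ioc 0 1 ∩ {s | 0 < Real.cos (Real.pi * (2 * s - 1)) - Real.cos (Real.pi * μ)}
      = Set.Ioo ((1 - μ) / 2) ((1 + μ) / 2) := by
    ext s
    simp only [Set.mem_inter_iff, Set.mem_Ioc, Set.mem_ofPred_eq, sub_pos, Set.mem_Ioo]
    constructor
    · rintro ⟨⟨a, b⟩, h⟩
      rw [cos_lt_cos_iff_lt_abs h0 h1 (abs_le.2 ⟨by linarith, by linarith⟩), abs_lt] at h
      constructor <;> linarith
    · rintro ⟨a, b⟩
      refine ⟨⟨by linarith, by linarith⟩, ?_⟩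
      rw [cos_lt_cos_iff_lt_abs h0 h1 (abs_le.2 ⟨by linarith, by linarith⟩), abs_lt]
      constructor <;> linarith
  rw [this, Real.volume_real_Ioo_of_le (by linarith)]
  ring

theorem volume_cos_sublevel {μ : ℝ} (h0 : 0 ≤ μ) (h1 : μ ≤ 1) :
    volume.real (Set.Ioc 0 1 ∩
      {s | 0 < Real.cos (Real.pi * μ) - Real.cos (Real.pi * (2 * s - 1))}) = 1 - μ := by
  have hp := Real.pi_pos
  have : Set.Ioc 0 1 ∩ {s | 0 < Real.cos (Real.pi * μ) - Real.cos (Real.pi * (2 * s - 1))}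
      = Set.Ioo 0 ((1 - μ) / 2) ∪ Set.Ioc ((1 + μ) / 2) 1 := by
    have key : ∀ s : ℝ, |s| ≤ 1 → (Real.cos (Real.pi * s) < Real.cos (Real.pi * μ) ↔ μ < |s|) := by
      intro s hs
      rw [← Real.cos_abs (Real.pi * s), abs_mul, abs_of_pos hp,
        Real.strictAntiOn_cos.lt_iff_gt ⟨by positivity, by nlinarith⟩
          ⟨by positivity, by nlinarith⟩]
      exact mul_lt_mul_iff_right₀ hp
    ext s
    simp only [Set.mem_inter_iff, Set.mem_Ioc, Set.mem_ofPred_eq, sub_pos, Set.mem_Ioo,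
      Set.mem_union]
    constructor
    · rintro ⟨⟨a, b⟩, h⟩
      rw [key _ (abs_le.2 ⟨by linarith, by linarith⟩), lt_abs] at h
      rcases h with h | h
      · right; constructor <;> linarith
      · left; constructor <;> linarith
    · intro h
      have hs : 0 < s ∧ s ≤ 1 := by
        rcases h with ⟨a, b⟩ | ⟨a, b⟩ <;> constructor <;> linarith
      refine ⟨hs, ?_⟩
      rw [key _ (abs_le.2 ⟨by linarith, by linarith⟩), lt_abs]
      rcases h with ⟨a, b⟩ | ⟨a, b⟩
      · right; linarith
      · left; linarith
  rw [this, measureReal_union ?_ ?_ (by simp) (by simp), Real.volume_real_Ioo_of_le (by linarith),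
    Real.volume_real_Ioc_of_le (by linarith)]
  · ring
  · rw [Set.disjoint_left]
    rintro s ⟨_, a⟩ ⟨b, _⟩
    linarith
  · exact measurableSet_Ioc

/-- A smooth periodic mean-zero approximation of the step function that takes the value `-μ₂` on a
fraction `μ₁` of each period and the value `μ₁` on a fraction `μ₂`. -/
theorem exists_periodic_profile {μ₁ μ₂ δ : ℝ} (hμ₁ : 0 ≤ μ₁) (hμ₂ : 0 ≤ μ₂) (hμ : μ₁ + μ₂ = 1)
    (hδ : 0 < δ) :
    ∃ h h₀ a₁ a₂ : ℝ → ℝ, ContDiff ℝ ∞ h ∧ Function.Periodic h 1 ∧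
      (∫ s in (0 : ℝ)..1, h s) = 0 ∧ (∀ s, h₀ s ∈ Set.Icc (-μ₂) μ₁) ∧ (∀ s, |h s - h₀ s| ≤ δ) ∧
      (ContDiff ℝ ∞ a₁ ∧ Function.Periodic a₁ 1 ∧ (∀ s, a₁ s ∈ Set.Icc 0 1) ∧
        (∀ s, a₁ s ≠ 0 → h₀ s = -μ₂) ∧ μ₁ - δ ≤ ∫ s in (0 : ℝ)..1, a₁ s) ∧
      (ContDiff ℝ ∞ a₂ ∧ Function.Periodic a₂ 1 ∧ (∀ s, a₂ s ∈ Set.Icc 0 1) ∧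
        (∀ s, a₂ s ≠ 0 → h₀ s = μ₁) ∧ μ₂ - δ ≤ ∫ s in (0 : ℝ)..1, a₂ s) := by
  -- Smooth and 1-periodic; on one period u exceeds c exactly where |2s - 1| < μ₁, a set of length
  -- μ₁.
  set u : ℝ → ℝ := fun s => Real.cos (Real.pi * (2 * s - 1)) with hu
  set c := Real.cos (Real.pi * μ₁)
  have hus : ContDiff ℝ ∞ u :=
    Real.contDiff_cos.comp
      (contDiff_const.mul ((contDiff_const.mul contDiff_id).sub contDiff_const))
  have hup : Function.Periodic u 1 := fun s => by
    simp only [hu]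
    rw [← Real.cos_add_two_pi (Real.pi * (2 * s - 1))]
    congr 1; ring
  have hc₁ : Continuous fun s => u s - c := hus.continuous.sub continuous_const
  have hc₂ : Continuous fun s => c - u s := continuous_const.sub hus.continuous
  have t₁ := tendsto_integral_smoothTransition hc₁ (le_refl 0)
  have t₂ := tendsto_integral_smoothTransition hc₂ zero_le_one
  have t₃ := tendsto_integral_smoothTransition hc₂ (le_refl 0)
  rw [volume_cos_superlevel hμ₁ (by linarith)] at t₁
  rw [volume_cos_sublevel hμ₁ (by linarith)] at t₂ t₃
  obtain ⟨K, k₁, k₂, k₃, k₄⟩ := ((t₁.eventually_const_lt (show μ₁ - δ < μ₁ by linarith)).and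
    ((t₂.eventually_const_lt (show 1 - μ₁ - δ < 1 - μ₁ by linarith)).and
    ((t₃.eventually_const_lt (show 1 - μ₁ - δ < 1 - μ₁ by linarith)).and
    (t₃.eventually_lt_const (show 1 - μ₁ < 1 - μ₁ + δ by linarith))))).exists
  set σ : ℝ → ℝ := Real.smoothTransition
  have hσ : ContDiff ℝ ∞ σ := Real.smoothTransition.contDiff
  have hKu : ∀ b : ℝ, ContDiff ℝ ∞ fun s => σ (K * (c - u s) - b) := fun b =>
    hσ.comp ((contDiff_const.mul (contDiff_const.sub hus)).sub contDiff_const)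
  set M := ∫ s in (0 : ℝ)..1, σ (K * (c - u s) - 0)
  -- The profile h subtracts the true mean M and h₀ the ideal mean μ₂, with |M - μ₂| ≤ δ for this K.
  -- Where a₁ ≠ 0 the transition is still 0; the shift by 1 in a₂ ensures that it has already
  -- reached 1 where a₂ ≠ 0.
  refine ⟨fun s => σ (K * (c - u s) - 0) - M, fun s => σ (K * (c - u s) - 0) - μ₂,
    fun s => σ (K * (u s - c) - 0), fun s => σ (K * (c - u s) - 1), (hKu 0).sub contDiff_const,
    fun s => ?_, ?_, fun s => ⟨?_, ?_⟩, fun s => ?_, ⟨?_, fun s => ?_, fun s => ?_,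
      fun s hs => ?_, k₁.le⟩,
    ⟨hKu 1, fun s => ?_, fun s => ?_, fun s hs => ?_, ?_⟩⟩
  · simp only [hup s]
  · rw [intervalIntegral.integral_sub ((hKu 0).continuous.intervalIntegrable _ _) (by simp)]
    simp [M]
  · linarith [Real.smoothTransition.nonneg (K * (c - u s) - 0)]
  · linarith [Real.smoothTransition.le_one (K * (c - u s) - 0)]
  · rw [abs_le]; constructor <;> linarith
  · exact hσ.comp ((contDiff_const.mul (hus.sub contDiff_const)).sub contDiff_const)
  · simp only [hup s]
  · exact ⟨Real.smoothTransition.nonneg _, Real.smoothTransition.le_one _⟩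
  · have : 0 < K * (u s - c) - 0 := by
      by_contra hcon
      exact hs (Real.smoothTransition.zero_of_nonpos (not_lt.1 hcon))
    have h2 : σ (K * (c - u s) - 0) = 0 := Real.smoothTransition.zero_of_nonpos (by linarith)
    simp only [h2]; ring
  · simp only [hup s]
  · exact ⟨Real.smoothTransition.nonneg _, Real.smoothTransition.le_one _⟩
  · have : 0 < K * (c - u s) - 1 := by
      by_contra hcon
      exact hs (Real.smoothTransition.zero_of_nonpos (not_lt.1 hcon))
    have h2 : σ (K * (c - u s) - 0) = 1 := Real.smoothTransition.one_of_one_le (by linarith)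
    simp only [h2]; linarith
  · linarith

/-! ### Averages of oscillating functions -/

theorem hasCompactSupport_planeWave {n : ℕ} (η : EuclideanSpace ℝ (Fin n)) {G : ℝ → ℝ}
    (hG : ContDiff ℝ ∞ G) {χ : smoothFn n} (hχ : HasCompactSupport χ.1) (N : ℝ) :
    HasCompactSupport (planeWave η G hG χ N).1 :=
  HasCompactSupport.mul_left hχ

theorem tsupport_planeWave_subset {n : ℕ} (η : EuclideanSpace ℝ (Fin n)) {G : ℝ → ℝ}
    (hG : ContDiff ℝ ∞ G) (χ : smoothFn n) (N : ℝ) :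
    tsupport (planeWave η G hG χ N).1 ⊆ tsupport χ.1 :=
  closure_mono (Function.support_mul_subset_right _ _)

theorem exists_integral_planeWave_bound {n : ℕ} (η : EuclideanSpace ℝ (Fin n)) {G : ℝ → ℝ}
    (hG : ContDiff ℝ ∞ G) (hper : Function.Periodic G 1) {χ : smoothFn n}
    (hχ : HasCompactSupport χ.1) :
    ∃ C, ∀ N, |∫ x, (planeWave η G hG χ N).1 x| ≤ C := by
  obtain ⟨C, hC⟩ := hper.exists_bound hG.continuous
  refine ⟨∫ x, C * |χ.1 x|, fun N => ?_⟩
  rw [← Real.norm_eq_abs]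
  refine norm_integral_le_of_norm_le ((smoothFn.integrable χ hχ).abs.const_mul C)
    (Filter.Eventually.of_forall fun x => ?_)
  change |G _ * χ.1 x| ≤ _
  rw [abs_mul]
  exact mul_le_mul_of_nonneg_right (hC _) (abs_nonneg _)

/-- Oscillating periodic functions converge weakly to their mean, with a rate. -/
theorem exists_integral_periodic_bound {n : ℕ} {η : EuclideanSpace ℝ (Fin n)}
    (hη : inner ℝ η η = (1 : ℝ)) {a : ℝ → ℝ}
    (ha : ContDiff ℝ ∞ a) (hper : Function.Periodic a 1) {f : smoothFn n}
    (hf : HasCompactSupport f.1) :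
    ∃ C, ∀ N : ℝ, 0 < N → |(∫ x, a (N * inner ℝ η x) * f.1 x)
      - (∫ s in (0 : ℝ)..1, a s) * ∫ x, f.1 x| ≤ C / N := by
  set M := ∫ s in (0 : ℝ)..1, a s with hM
  have hH : ContDiff ℝ ∞ fun s => a s - M := ha.sub contDiff_const
  have hHper : Function.Periodic (fun s => a s - M) 1 := fun s => by simp only [hper s]
  obtain ⟨A, hA, hAper, -, hAd⟩ := hHper.exists_primitive hH (by
    rw [intervalIntegral.integral_sub (ha.continuous.intervalIntegrable _ _) (by simp)]
    simp [hM])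
  choose C hC using fun j => exists_integral_planeWave_bound η hA hAper
    (hasCompactSupport_pd j hf)
  refine ⟨∑ j, |η j| * C j, fun N hN => ?_⟩
  set W := planeWave η (deriv A) (contDiff_deriv hA) f N with hW
  have hWc : HasCompactSupport W.1 := hasCompactSupport_planeWave η _ hf N
  -- The integral of ∂ⱼ of the wave with profile A vanishes. Weighting these identities by ηⱼ and
  -- summing, with |η| = 1, isolates N times the wanted integral.
  have hz : ∀ j, N * η j * (∫ x, W.1 x) + ∫ x, (planeWave η A hA (pd j f) N).1 x = 0 := by
    intro j
    rw [← integral_pd j _ (hasCompactSupport_planeWave η hA hf N), pd_planeWave,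
      ← integral_const_mul]
    exact (integral_add ((smoothFn.integrable _ hWc).const_mul (N * η j)) (smoothFn.integrable _
      (hasCompactSupport_planeWave η hA (hasCompactSupport_pd j hf) N))).symm
  have hηs : ∑ j, η j * η j = 1 := by
    rw [← hη, PiLp.inner_apply]; simp [sq]
  have hNW : N * ∫ x, W.1 x = -∑ j, η j * ∫ x, (planeWave η A hA (pd j f) N).1 x := by
    have h1 : ∑ j, η j * (N * η j * (∫ x, W.1 x) +
        ∫ x, (planeWave η A hA (pd j f) N).1 x) = 0 := by simp [hz]
    have h2 : ∑ j, η j * (N * η j * ∫ x, W.1 x) = N * ∫ x, W.1 x := by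
      rw [← one_mul (N * _), ← hηs, Finset.sum_mul]
      exact Finset.sum_congr rfl fun j _ => by ring
    simp only [mul_add, Finset.sum_add_distrib] at h1
    rw [h2] at h1
    linarith
  have hWe : ∫ x, W.1 x = (∫ x, a (N * inner ℝ η x) * f.1 x) - M * ∫ x, f.1 x := by
    rw [← integral_const_mul, ← integral_sub]
    · refine integral_congr_ae (Filter.Eventually.of_forall fun x => ?_)
      change deriv A _ * f.1 x = _
      rw [hAd]
      ring
    · exact smoothFn.integrable _ (hasCompactSupport_planeWave η ha hf N)
    · exact (smoothFn.integrable f hf).const_mul M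
  rw [← hWe, le_div_iff₀ hN, mul_comm, ← abs_of_pos hN, ← abs_mul, hNW, abs_neg]
  refine (Finset.abs_sum_le_sum_abs _ _).trans (Finset.sum_le_sum fun j _ => ?_)
  rw [abs_mul]
  exact mul_le_mul_of_nonneg_left (hC j N) (abs_nonneg _)

/-! ### Cutoffs and fields with values in the state space -/

theorem exists_smoothFn_cutoff {n : ℕ} {K O : Set (EuclideanSpace ℝ (Fin n))} (hK : IsCompact K)
    (hO : IsOpen O) (hKO : K ⊆ O) :
    ∃ f : smoothFn n, HasCompactSupport f.1 ∧ tsupport f.1 ⊆ O ∧ (∀ x, f.1 x ∈ Set.Icc 0 1) ∧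
      ∀ x ∈ K, f.1 x = 1 := by
  obtain ⟨L, hL, hKL, hLO⟩ := exists_compact_between hK hO hKO
  obtain ⟨f, h0, h1, h01⟩ := exists_contMDiffMap_zero_one_of_isClosed (n := (⊤ : ℕ∞))
    (modelWithCornersSelf ℝ (EuclideanSpace ℝ (Fin n)))
    (isOpen_interior (s := L)).isClosed_compl hK.isClosed
    (Set.disjoint_left.2 fun x hx hxK => hx (hKL hxK))
  have hts : tsupport f ⊆ L := by
    refine closure_minimal (fun x hx => ?_) hL.isClosed
    by_contra hxL
    exact hx (h0 fun h => hxL (interior_subset h))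
  exact ⟨⟨f, f.contMDiff.contDiff⟩, hL.of_isClosed_subset (isClosed_tsupport _) hts,
    hts.trans hLO, h01, fun x hx => h1 hx⟩

theorem euclidean_norm_le_sum {ι : Type*} [Fintype ι] (v : EuclideanSpace ℝ ι) :
    ‖v‖ ≤ ∑ i, |v i| := by
  classical
  have h : v = ∑ i, EuclideanSpace.single i (v i) := by
    ext j
    simp
  conv_lhs => rw [h]
  refine (norm_sum_le _ _).trans (le_of_eq ?_)
  simp

theorem State.norm_le {n : ℕ} (z : State n) :
    ‖z‖ ≤ ∑ i, |z.vec i| + ∑ i, ∑ j, |z.mat i j| := by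
  have h1 : ‖z‖ ≤ ‖z.fst‖ + ‖z.snd‖ := by
    rw [← sq_le_sq₀ (norm_nonneg _) (by positivity), WithLp.prod_norm_sq_eq_of_L2]
    nlinarith [mul_nonneg (norm_nonneg z.fst) (norm_nonneg z.snd)]
  refine h1.trans (add_le_add (euclidean_norm_le_sum _) ?_)
  refine (euclidean_norm_le_sum (z.snd : EuclideanSpace ℝ (Fin n × Fin n))).trans (le_of_eq ?_)
  rw [Fintype.sum_prod_type]
  rfl

theorem State.ext_components {n : ℕ} {z z' : State n} (h : ∀ i, z.vec i = z'.vec i)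
    (h' : ∀ i j, z.mat i j = z'.mat i j) : z = z' := by
  rw [← sub_eq_zero, ← norm_le_zero_iff]
  refine (State.norm_le _).trans (le_of_eq ?_)
  have e1 : ∀ i, (z - z').vec i = z.vec i - z'.vec i := fun i => rfl
  have e2 : ∀ i j, (z - z').mat i j = z.mat i j - z'.mat i j := fun i j => rfl
  simp [e1, e2, h, h']

theorem exists_state_field {n : ℕ} (f : Fin n → smoothFn n) (V : Fin n → Fin n → smoothFn n)
    (hsymm : ∀ i j, V i j = V j i) (htr : ∑ i, V i i = 0) :
    ∃ w : EuclideanSpace ℝ (Fin n) → State n, ContDiff ℝ ∞ w ∧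
      (∀ x i, (w x).vec i = (f i).1 x) ∧ (∀ x i j, (w x).mat i j = (V i j).1 x) := by
  set m : EuclideanSpace ℝ (Fin n) → EuclideanSpace ℝ (Fin n) :=
    fun x => WithLp.toLp 2 fun i => (f i).1 x
  set A : EuclideanSpace ℝ (Fin n) → EuclideanSpace ℝ (Fin n × Fin n) :=
    fun x => WithLp.toLp 2 fun ij => (V ij.1 ij.2).1 x
  have hm : ContDiff ℝ ∞ m := contDiff_euclidean.2 fun i => (f i).2
  have hA : ContDiff ℝ ∞ A := contDiff_euclidean.2 fun ij => (V ij.1 ij.2).2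
  have hmem : ∀ x, A x ∈ SymTraceless n := fun x => by
    constructor
    · ext i j
      change (V j i).1 x = (V i j).1 x
      rw [hsymm]
    · have := congrFun (congrArg Subtype.val htr) x
      simpa [Matrix.trace, toMat, A] using this
  -- The projection fixes A x, which is already symmetric and trace-free; it only supplies a smooth
  -- map into the subspace.
  refine ⟨fun x => WithLp.toLp 2 (m x, (SymTraceless n).orthogonalProjectionOnto (A x)), ?_,
    fun x i => rfl, fun x i j => ?_⟩
  · exact (WithLp.prodContinuousLinearEquiv 2 ℝ _ _).symm.contDiff.comp
      (hm.prodMk ((SymTraceless n).orthogonalProjectionOnto.contDiff.comp hA))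
  · have : (SymTraceless n).orthogonalProjectionOnto (A x) = ⟨A x, hmem x⟩ :=
      Submodule.orthogonalProjectionOnto_mem_subspace_eq_self ⟨A x, hmem x⟩
    change toMat ((SymTraceless n).orthogonalProjectionOnto (A x) :
      EuclideanSpace ℝ (Fin n × Fin n)) i j = _
    rw [this]
    rfl

/-- A component of the vector part as a continuous linear functional. -/
noncomputable def State.vecCLM {n : ℕ} (i : Fin n) : State n →L[ℝ] ℝ :=
  LinearMap.toContinuousLinearMap
    { toFun := fun z => z.vec i
      map_add' := fun _ _ => rfl
      map_smul' := fun _ _ => rfl }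

/-- An entry of the matrix part as a continuous linear functional. -/
noncomputable def State.matCLM {n : ℕ} (i j : Fin n) : State n →L[ℝ] ℝ :=
  LinearMap.toContinuousLinearMap
    { toFun := fun z => z.mat i j
      map_add' := fun _ _ => rfl
      map_smul' := fun _ _ => rfl }

theorem State.integral_eq_zero {n : ℕ} {w : EuclideanSpace ℝ (Fin n) → State n}
    (hw : Integrable w) (h : ∀ i, ∫ x, (w x).vec i = 0) (h' : ∀ i j, ∫ x, (w x).mat i j = 0) :
    ∫ x, w x = 0 := by
  refine State.ext_components (fun i => ?_) (fun i j => ?_)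
  · exact ((State.vecCLM i).integral_comp_comm hw).symm.trans (h i)
  · exact ((State.matCLM i j).integral_comp_comm hw).symm.trans (h' i j)

/-! ### Oscillating exact solutions -/

theorem diffOp_planeWave_top {n k : ℕ} (η : EuclideanSpace ℝ (Fin n))
    {p : MvPolynomial (Fin n) ℝ} (hp : p.IsHomogeneous k)
    {G : ℝ → ℝ} (hG : ContDiff ℝ ∞ G) (hper : Function.Periodic G 1) {χ : smoothFn n}
    (hχ : HasCompactSupport χ.1) :
    ∃ C, 0 ≤ C ∧ ∀ N : ℝ, 1 ≤ N → ∀ x,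
      |(N ^ k)⁻¹ * (diffOp n p (planeWave η G hG χ N)).1 x
        - MvPolynomial.eval (fun j => η j) p * (deriv^[k] G (N * inner ℝ η x) * χ.1 x)|
        ≤ C / N := by
  obtain ⟨C, hC0, hC⟩ := diffOp_planeWave_bound η p hp G hG hper χ hχ
  refine ⟨C, hC0, fun N hN x => ?_⟩
  have hN0 : 0 < N := by linarith
  have hk : 0 < N ^ k := pow_pos hN0 k
  have e : (N ^ k)⁻¹ * (diffOp n p (planeWave η G hG χ N)).1 x
        - MvPolynomial.eval (fun j => η j) p * (deriv^[k] G (N * inner ℝ η x) * χ.1 x)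
      = (N ^ k)⁻¹ * ((diffOp n p (planeWave η G hG χ N)).1 x
        - N ^ k * MvPolynomial.eval (fun j => η j) p *
          (deriv^[k] G (N * inner ℝ η x) * χ.1 x)) := by
    field_simp
  rw [e, abs_mul, abs_of_pos (inv_pos.2 hk), le_div_iff₀ hN0, inv_mul_eq_div, div_mul_eq_mul_div,
    div_le_iff₀ hk, mul_comm |_|]
  exact hC N hN x

/-- The normalization has one power of N more than the order of the operator. This makes the
corrector r negligible. -/
theorem diffOp_planeWave_lower {n k : ℕ} (η : EuclideanSpace ℝ (Fin n))
    {p : MvPolynomial (Fin n) ℝ} (hp : p.IsHomogeneous k)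
    {G : ℝ → ℝ} (hG : ContDiff ℝ ∞ G) (hper : Function.Periodic G 1) {χ : smoothFn n}
    (hχ : HasCompactSupport χ.1) :
    ∃ C, 0 ≤ C ∧ ∀ N : ℝ, 1 ≤ N → ∀ x,
      |(N ^ (k + 1))⁻¹ * (diffOp n p (planeWave η G hG χ N)).1 x| ≤ C / N := by
  obtain ⟨C, hC0, hC⟩ := diffOp_planeWave_top η hp hG hper hχ
  obtain ⟨C₁, h₁⟩ := (periodic_iterate_deriv hper k).exists_bound
    (contDiff_iterate_deriv hG k).continuous
  obtain ⟨C₂, h₂⟩ := smoothFn.exists_bound χ hχ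
  set e := MvPolynomial.eval (fun j => η j) p
  have hC₁ : 0 ≤ C₁ := (abs_nonneg _).trans (h₁ 0)
  have hC₂ : 0 ≤ C₂ := (abs_nonneg _).trans (h₂ 0)
  refine ⟨C + |e| * (C₁ * C₂), by positivity, fun N hN x => ?_⟩
  have hN0 : 0 < N := by linarith
  rw [pow_succ, mul_inv, mul_comm (N ^ k)⁻¹, mul_assoc, abs_mul, abs_of_pos (inv_pos.2 hN0),
    inv_mul_eq_div]
  gcongr
  have h3 := hC N hN x
  have h4 : |e * (deriv^[k] G (N * inner ℝ η x) * χ.1 x)| ≤ |e| * (C₁ * C₂) := by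
    rw [abs_mul, abs_mul]
    gcongr
    · exact h₁ _
    · exact h₂ _
  have h5 : C / N ≤ C := div_le_self hC0 hN
  have h6 := abs_add_le ((N ^ k)⁻¹ * (diffOp n p (planeWave η G hG χ N)).1 x
    - e * (deriv^[k] G (N * inner ℝ η x) * χ.1 x)) (e * (deriv^[k] G (N * inner ℝ η x) * χ.1 x))
  rw [sub_add_cancel] at h6
  linarith

theorem State.mat_mem {n : ℕ} (z : State n) : z.matᵀ = z.mat ∧ z.mat.trace = 0 :=
  z.snd.2

theorem exists_unit_of_mem_waveCone {n : ℕ} {z : State n} (hz : z ∈ waveCone n) :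
    ∃ η : EuclideanSpace ℝ (Fin n), inner ℝ η η = (1 : ℝ) ∧ inner ℝ z.vec η = 0 ∧
      z.mat *ᵥ η.ofLp = 0 := by
  obtain ⟨η, hη, h1, h2⟩ := hz
  refine ⟨‖η‖⁻¹ • η, ?_, ?_, ?_⟩
  · rw [real_inner_self_eq_norm_sq, norm_smul, norm_inv, norm_norm,
      inv_mul_cancel₀ (norm_ne_zero_iff.2 hη), one_pow]
  · rw [inner_smul_right, h1, mul_zero]
  · rw [WithLp.ofLp_smul, Matrix.mulVec_smul, h2, smul_zero]

/-- Highly oscillating localized solutions of `∇ · m = 0`, `∇ · V = B m` that follow a prescribed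
direction of the wave cone. -/
theorem exists_oscillating_solutions {n : ℕ} (B : Matrix (Fin n) (Fin n) ℝ) {z : State n}
    {η : EuclideanSpace ℝ (Fin n)} (hη : inner ℝ η η = (1 : ℝ)) (hzη : inner ℝ z.vec η = 0)
    (hzη' : z.mat *ᵥ η.ofLp = 0) {G : ℝ → ℝ} (hG : ContDiff ℝ ∞ G)
    (hper : Function.Periodic G 1) {χ : smoothFn n} (hχ : HasCompactSupport χ.1) :
    ∃ C, 0 ≤ C ∧ ∀ N : ℝ, 1 ≤ N → ∃ w : EuclideanSpace ℝ (Fin n) → State n,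
      ContDiff ℝ ∞ w ∧ tsupport w ⊆ tsupport χ.1 ∧ ∫ x, w x = 0 ∧
      (∀ x, divVec (fun y => (w y).vec) x = 0) ∧
      (∀ x, divMat (fun y => (w y).mat) x - B *ᵥ (w x).vec.ofLp = 0) ∧
      ∀ x, ‖w x - (deriv^[5] G (N * inner ℝ η x) * χ.1 x) • z‖ ≤ C / N := by
  have hη' : η.ofLp ⬝ᵥ η.ofLp = 1 := by
    rw [← hη, PiLp.inner_apply]; simp [dotProduct, sq]
  have hm : z.vec.ofLp ⬝ᵥ η.ofLp = 0 := by
    rw [← hzη, PiLp.inner_apply]; simp [dotProduct, mul_comm]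
  obtain ⟨p, q, r, hp, hq, hr, hXp, hqX, hrX, hqt, hrt, hqtr, hrtr, hpe, hqe⟩ :=
    exists_potential_symbols B η.ofLp z.vec.ofLp z.mat hη' z.mat_mem.1 z.mat_mem.2 hm hzη'
  choose Cp hCp0 hCp using fun i => diffOp_planeWave_top η (hp i) hG hper hχ
  choose Cq hCq0 hCq using fun i j => diffOp_planeWave_top η (hq i j) hG hper hχ
  choose Cr hCr0 hCr using fun i j => diffOp_planeWave_lower η (hr i j) hG hper hχ
  refine ⟨∑ i, Cp i + ∑ i, ∑ j, (Cq i j + Cr i j), ?_, fun N hN => ?_⟩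
  · exact add_nonneg (Finset.sum_nonneg fun i _ => hCp0 i)
      (Finset.sum_nonneg fun i _ => Finset.sum_nonneg fun j _ => add_nonneg (hCq0 i j) (hCr0 i j))
  set φ := planeWave η G hG χ N
  have hφ : HasCompactSupport φ.1 := hasCompactSupport_planeWave η hG hχ N
  -- Compensates the factor N⁵ produced by five derivatives of G(Nη·x).
  set c := (N ^ 5)⁻¹ with hc
  obtain ⟨w, hw, hwv, hwm⟩ := exists_state_field (fun i => diffOp n (p i) (c • φ))
    (fun i j => diffOp n (q i j + r i j) (c • φ))
    (fun i j => by
      rw [← congrFun (congrFun hqt i) j, ← congrFun (congrFun hrt i) j]; rfl)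
    (by
      have : ∑ i, (q i i + r i i) = 0 := by
        rw [Finset.sum_add_distrib]
        change q.trace + r.trace = 0
        rw [hqtr, hrtr, add_zero]
      rw [← LinearMap.sum_apply, ← map_sum, this]; simp)
  have hcφ : HasCompactSupport (c • φ).1 := hφ.of_isClosed_subset (isClosed_tsupport _)
    (closure_mono (Function.support_const_smul_subset c φ.1))
  have hsub : ∀ s : MvPolynomial (Fin n) ℝ, tsupport (diffOp n s (c • φ)).1 ⊆ tsupport χ.1 :=
    fun s => (tsupport_diffOp_subset s _).trans
      ((closure_mono (Function.support_const_smul_subset c φ.1)).trans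
        (tsupport_planeWave_subset η hG χ N))
  have hts : tsupport w ⊆ tsupport χ.1 := by
    refine closure_minimal (fun x hx => ?_) (isClosed_tsupport _)
    by_contra hxχ
    refine hx (State.ext_components (fun i => ?_) fun i j => ?_)
    · rw [hwv]
      exact image_eq_zero_of_notMem_tsupport fun h => hxχ (hsub _ h)
    · rw [hwm]
      exact image_eq_zero_of_notMem_tsupport fun h => hxχ (hsub _ h)
  have hwc : HasCompactSupport w := hχ.of_isClosed_subset (isClosed_tsupport _) hts
  have hzero : ∀ {k : ℕ} {s : MvPolynomial (Fin n) ℝ}, s.IsHomogeneous (k + 1) →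
      MvPolynomial.constantCoeff s = 0 := fun hs => by
    rw [MvPolynomial.constantCoeff_eq]
    exact hs.coeff_eq_zero (by simp)
  refine ⟨w, hw, hts, ?_, fun x => ?_, fun x => ?_, fun x => ?_⟩
  · refine State.integral_eq_zero (hw.continuous.integrable_of_hasCompactSupport hwc)
      (fun i => ?_) fun i j => ?_
    · simp only [hwv]
      rw [integral_diffOp _ _ hcφ, hzero (hp i), zero_mul]
    · simp only [hwm]
      rw [integral_diffOp _ _ hcφ, map_add, hzero (hq i j), hzero (hr i j), add_zero, zero_mul]
  · have h1 : ∑ j, pd j (diffOp n (p j) (c • φ)) = 0 := by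
      simp only [← diffOp_X_mul]
      rw [← LinearMap.sum_apply, ← map_sum]
      change diffOp n (MvPolynomial.X ⬝ᵥ p) _ = 0
      rw [hXp]; simp
    have h2 := congrFun (congrArg Subtype.val h1) x
    simp only [divVec, hwv]
    rw [AddSubmonoidClass.coe_finsetSum, Finset.sum_apply] at h2
    exact h2
  · ext i
    have h1 : ∑ j, pd j (diffOp n (q i j + r i j) (c • φ))
        = ∑ j, B i j • diffOp n (p j) (c • φ) := by
      have hq' : ∑ j, MvPolynomial.X j * q i j = 0 := by
        have := congrFun hqX i
        simpa [Matrix.mulVec, dotProduct, mul_comm] using this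
      have hr' : ∑ j, MvPolynomial.X j * r i j = ∑ j, MvPolynomial.C (B i j) * p j := by
        have := congrFun hrX i
        simpa [Matrix.mulVec, dotProduct, mul_comm] using this
      have h3 : ∀ j, B i j • diffOp n (p j) (c • φ)
          = diffOp n (MvPolynomial.C (B i j) * p j) (c • φ) := fun j => by
        rw [map_mul]
        exact (diffOp_C _ _).symm
      simp only [← diffOp_X_mul, h3]
      rw [← LinearMap.sum_apply, ← map_sum, ← LinearMap.sum_apply, ← map_sum]
      simp only [mul_add, Finset.sum_add_distrib]
      rw [hq', hr', zero_add]
    have h2 := congrFun (congrArg Subtype.val h1) x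
    simp only [Pi.sub_apply, divMat, hwm, Matrix.mulVec, dotProduct, hwv, Pi.zero_apply]
    rw [sub_eq_zero]
    rw [AddSubmonoidClass.coe_finsetSum, AddSubmonoidClass.coe_finsetSum, Finset.sum_apply,
      Finset.sum_apply] at h2
    exact h2
  · refine (State.norm_le _).trans ?_
    rw [add_div, Finset.sum_div, Finset.sum_div]
    have hval : ∀ s, (diffOp n s (c • φ)).1 x = c * (diffOp n s φ).1 x := fun s => by
      rw [map_smul]; rfl
    refine add_le_add (Finset.sum_le_sum fun i _ => ?_) (Finset.sum_le_sum fun i _ => ?_)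
    · change |(w x).vec i - _ * z.vec i| ≤ _
      rw [hwv, hval, mul_comm _ (z.vec i), ← hpe i]
      exact hCp i N hN x
    · rw [Finset.sum_div]
      refine Finset.sum_le_sum fun j _ => ?_
      change |(w x).mat i j - _ * z.mat i j| ≤ _
      rw [hwm, map_add, LinearMap.add_apply]
      change |(diffOp n (q i j) (c • φ)).1 x + (diffOp n (r i j) (c • φ)).1 x - _| ≤ _
      rw [hval, hval, mul_comm _ (z.mat i j), ← hqe i j, add_sub_right_comm, add_div]
      exact (abs_add_le _ _).trans (add_le_add (hCq i j N hN x) (hCr i j N hN x))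

/-! ### Volume estimates -/

theorem exists_isCompact_measureReal_gt {n : ℕ} {O : Set (EuclideanSpace ℝ (Fin n))}
    (hO : IsOpen O) (hOfin : volume O < ⊤) {δ : ℝ} (hδ : 0 < δ) :
    ∃ K ⊆ O, IsCompact K ∧ volume.real O - δ ≤ volume.real K := by
  obtain ⟨K, hKO, hK, h⟩ := hO.measurableSet.exists_isCompact_lt_add hOfin.ne
    (ε := ENNReal.ofReal δ) (by simpa using hδ)
  refine ⟨K, hKO, hK, ?_⟩
  have h2 := ENNReal.toReal_mono
    (ENNReal.add_ne_top.2 ⟨hK.measure_lt_top.ne, ENNReal.ofReal_ne_top⟩) h.le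
  rw [ENNReal.toReal_add hK.measure_lt_top.ne ENNReal.ofReal_ne_top,
    ENNReal.toReal_ofReal hδ.le] at h2
  simp only [measureReal_def]
  linarith

theorem le_integral_of_eq_one_on {n : ℕ} {f : smoothFn n} (hf : HasCompactSupport f.1)
    (h0 : ∀ x, 0 ≤ f.1 x) {K : Set (EuclideanSpace ℝ (Fin n))} (hK : IsCompact K)
    (h1 : ∀ x ∈ K, f.1 x = 1) : volume.real K ≤ ∫ x, f.1 x := by
  rw [← integral_indicator_one hK.measurableSet]
  refine integral_mono ((integrable_indicator_iff hK.measurableSet).2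
    (integrableOn_const (C := (1 : ℝ)) hK.measure_lt_top.ne)) (smoothFn.integrable f hf) fun x => ?_
  by_cases hx : x ∈ K
  · simp [hx, h1 x hx]
  · simpa [hx] using h0 x

theorem integral_le_of_support_subset {n : ℕ} {f : EuclideanSpace ℝ (Fin n) → ℝ}
    (hf : Integrable f) (h1 : ∀ x, f x ≤ 1) {S : Set (EuclideanSpace ℝ (Fin n))}
    (hS : MeasurableSet S) (hSfin : volume S ≠ ⊤) (hsupp : ∀ x, f x ≠ 0 → x ∈ S) :
    ∫ x, f x ≤ volume.real S := by
  rw [← integral_indicator_one hS]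
  refine integral_mono hf
    ((integrable_indicator_iff hS).2 (integrableOn_const (C := (1 : ℝ)) hSfin)) fun x => ?_
  by_cases hx : x ∈ S
  · simp [hx, h1 x]
  · have : f x = 0 := by by_contra h; exact hx (hsupp x h)
    simp [hx, this]

theorem isOpen_support_planeWave {n : ℕ} (η : EuclideanSpace ℝ (Fin n)) {a : ℝ → ℝ}
    (ha : ContDiff ℝ ∞ a) (f : smoothFn n) (N : ℝ) :
    IsOpen {x | a (N * inner ℝ η x) * f.1 x ≠ 0} :=
  isOpen_ne_fun (smoothFn.contDiff (planeWave η a ha f N)).continuous continuous_const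

theorem mul_mem_Icc_neg {a b s t : ℝ} (ha : 0 ≤ a) (hb : 0 ≤ b) (hs : s ∈ Set.Icc (-b) a)
    (ht : t ∈ Set.Icc 0 1) : s * t ∈ Set.Icc (-b) a := by
  obtain ⟨h1, h2⟩ := hs
  obtain ⟨h3, h4⟩ := ht
  constructor <;> nlinarith

theorem add_smul_sub_mem_segment {E : Type*} [AddCommGroup E] [Module ℝ E] {x y : E}
    {a b t : ℝ} (hab : a + b = 1) (ht : t ∈ Set.Icc (-b) a) :
    a • x + b • y + t • (y - x) ∈ segment ℝ x y := by
  refine ⟨a - t, b + t, sub_nonneg.2 ht.2, by linarith [ht.1], by linarith, ?_⟩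
  module

/-- A lower bound for the volume of the set where a localized oscillation is nonzero. -/
theorem volume_support_gt {n : ℕ} {η : EuclideanSpace ℝ (Fin n)} {a : ℝ → ℝ}
    (ha : ContDiff ℝ ∞ a) (ha01 : ∀ s, a s ∈ Set.Icc 0 1) {f : smoothFn n}
    (hfc : HasCompactSupport f.1) (hf01 : ∀ x, f.1 x ∈ Set.Icc 0 1)
    {O : Set (EuclideanSpace ℝ (Fin n))} (hO : IsOpen O) (hOfin : volume O < ⊤)
    (hfO : ∀ x, f.1 x ≠ 0 → x ∈ O) {δ ε μ c N : ℝ} (hfge : volume.real O - δ ≤ ∫ x, f.1 x)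
    (hδ : δ * volume.real O + δ ≤ ε / 2) (haint : μ - δ ≤ ∫ s in (0 : ℝ)..1, a s)
    (hc : c / N < ε / 2) (hac : |(∫ x, a (N * inner ℝ η x) * f.1 x)
      - (∫ s in (0 : ℝ)..1, a s) * ∫ x, f.1 x| ≤ c / N) :
    μ * volume.real O - ε < volume.real {x | a (N * inner ℝ η x) * f.1 x ≠ 0} := by
  have hfle : ∫ x, f.1 x ≤ volume.real O :=
    integral_le_of_support_subset (smoothFn.integrable f hfc)
      (fun x => (hf01 x).2) hO.measurableSet hOfin.ne hfO
  have hsub : {x | a (N * inner ℝ η x) * f.1 x ≠ 0} ⊆ O := fun x hx =>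
    hfO x (right_ne_zero_of_mul hx)
  have h1 : ∫ x, a (N * inner ℝ η x) * f.1 x ≤
      volume.real {x | a (N * inner ℝ η x) * f.1 x ≠ 0} :=
    integral_le_of_support_subset (f := fun x => a (N * inner ℝ η x) * f.1 x)
      (smoothFn.integrable _ (hasCompactSupport_planeWave η ha hfc N))
      (fun x => mul_le_one₀ (ha01 _).2 (hf01 x).1 (hf01 x).2)
      (isOpen_support_planeWave η ha f N).measurableSet
      ((measure_mono hsub).trans_lt hOfin).ne fun x hx => hx
  have h2 : 0 ≤ ∫ s in (0 : ℝ)..1, a s :=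
    intervalIntegral.integral_nonneg zero_le_one fun s _ => (ha01 s).1
  have h3 : ∫ s in (0 : ℝ)..1, a s ≤ 1 := by
    have := intervalIntegral.integral_mono_on (μ := volume) zero_le_one
      (ha.continuous.intervalIntegrable _ _)
      (continuous_const.intervalIntegrable (0 : ℝ) 1) fun s _ => (ha01 s).2
    simpa using this
  have h4 := (abs_le.1 hac).1
  set I := ∫ s in (0 : ℝ)..1, a s
  set F := ∫ x, f.1 x
  -- Losses relative to μ|O|: δ from the cutoff, δ|O| from the mean of a, and c/N from the
  -- oscillation. Together they stay below ε.
  have h5 : I * (volume.real O - F) ≤ 1 * δ :=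
    mul_le_mul h3 (by linarith) (by linarith) zero_le_one
  have h6 : (μ - δ) * volume.real O ≤ I * volume.real O :=
    mul_le_mul_of_nonneg_right haint measureReal_nonneg
  linarith

/-! ### Assembly of the localized oscillation -/

theorem lemma2p6 (n : ℕ) (B : Matrix (Fin n) (Fin n) ℝ)
    (w w₁ w₂ : State n) (μ₁ μ₂ : ℝ) (hμ₁ : 0 ≤ μ₁) (hμ₂ : 0 ≤ μ₂) (hμ : μ₁ + μ₂ = 1)
    (hw : w = μ₁ • w₁ + μ₂ • w₂) (hcone : w₂ - w₁ ∈ waveCone n)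
    (O : Set (EuclideanSpace ℝ (Fin n))) (hO : IsOpen O) (hOfin : volume O < ⊤)
    (ε : ℝ) (hε : 0 < ε) :
    ∃ w' : EuclideanSpace ℝ (Fin n) → State n,
      ContDiff ℝ ∞ w' ∧ HasCompactSupport w' ∧ tsupport w' ⊆ O ∧
      (∫ x in O, w' x) = 0 ∧
      (∀ x, divVec (fun y => (w' y).vec) x = 0) ∧
      (∀ x, divMat (fun y => (w' y).mat) x - B *ᵥ (w' x).vec.ofLp = 0) ∧
      (∀ x ∈ O, Metric.infDist (w + w' x) (segment ℝ w₁ w₂) < ε) ∧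
      ∃ O₁ O₂ : Set (EuclideanSpace ℝ (Fin n)),
        IsOpen O₁ ∧ IsOpen O₂ ∧ O₁ ⊆ O ∧ O₂ ⊆ O ∧ Disjoint O₁ O₂ ∧
        (∀ x ∈ O₁, ‖w + w' x - w₁‖ < ε) ∧ (∀ x ∈ O₂, ‖w + w' x - w₂‖ < ε) ∧
        |volume.real O₁ - μ₁ * volume.real O| < ε ∧
        |volume.real O₂ - μ₂ * volume.real O| < ε := by
  obtain ⟨η, hη, hzη, hzη'⟩ := exists_unit_of_mem_waveCone hcone
  set z := w₂ - w₁ with hz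
  set v := volume.real O
  have hv : 0 ≤ v := measureReal_nonneg
  -- Makes both δ‖z‖ and δ|O| + δ at most ε/2; the other half of ε is reserved for the 1/N errors.
  set δ := ε / (2 * (‖z‖ + v + 1)) with hδdef
  have hden : 0 < ‖z‖ + v + 1 := by positivity
  have hδ : 0 < δ := by positivity
  have hδe : δ * (‖z‖ + v + 1) = ε / 2 := by rw [hδdef]; field_simp
  have hδz : δ * ‖z‖ ≤ ε / 2 := by nlinarith
  have hδv : δ * v + δ ≤ ε / 2 := by nlinarith [norm_nonneg z]
  obtain ⟨h, h₀, a₁, a₂, hh, hhper, hhint, hh₀, hhh₀, ⟨ha₁, ha₁per, ha₁01, ha₁h, ha₁int⟩,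
    ha₂, ha₂per, ha₂01, ha₂h, ha₂int⟩ := exists_periodic_profile hμ₁ hμ₂ hμ hδ
  obtain ⟨G, hG, hGper, hGh⟩ := hhper.exists_iterate_primitive 5 hh hhint
  obtain ⟨K, hKO, hK, hKv⟩ := exists_isCompact_measureReal_gt hO hOfin hδ
  obtain ⟨f, hfc, hfO, hf01, hfK⟩ := exists_smoothFn_cutoff hK hO hKO
  -- Two nested cutoffs: χ localizes the wave and equals 1 on supp f, so the wave is undamped
  -- wherever f ≠ 0.
  obtain ⟨χ, hχc, hχO, hχ01, hχf⟩ := exists_smoothFn_cutoff hfc.isCompact hO hfO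
  obtain ⟨C, hC0, hC⟩ := exists_oscillating_solutions B hη hzη hzη' hG hGper hχc
  obtain ⟨C₁, hC₁⟩ := exists_integral_periodic_bound hη ha₁ ha₁per hfc
  obtain ⟨C₂, hC₂⟩ := exists_integral_periodic_bound hη ha₂ ha₂per hfc
  obtain ⟨N, hN⟩ := exists_nat_gt (max 1 ((|C| + |C₁| + |C₂|) / (ε / 2)))
  have hN1 : (1 : ℝ) ≤ N := (le_max_left _ _).trans hN.le
  have hN0 : (0 : ℝ) < N := by linarith
  have hNC : |C| + |C₁| + |C₂| < ε / 2 * N := by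
    have := (le_max_right _ _).trans_lt hN
    rwa [div_lt_iff₀' (by positivity)] at this
  have small : ∀ c, c ≤ |C| + |C₁| + |C₂| → c / N < ε / 2 := fun c hc => by
    rw [div_lt_iff₀ hN0]; linarith
  have hCN : C / N < ε / 2 :=
    small C (by linarith [le_abs_self C, abs_nonneg C₁, abs_nonneg C₂])
  have hC₁N : C₁ / N < ε / 2 :=
    small C₁ (by linarith [le_abs_self C₁, abs_nonneg C, abs_nonneg C₂])
  have hC₂N : C₂ / N < ε / 2 :=
    small C₂ (by linarith [le_abs_self C₂, abs_nonneg C₁, abs_nonneg C])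
  obtain ⟨w', hw's, hw'supp, hw'int, hdiv, hdivM, hclose⟩ := hC N hN1
  rw [hGh] at hclose
  have hw1 : w = w₁ + μ₂ • z := by
    rw [hw, hz, eq_sub_of_add_eq hμ]; module
  have hw2 : w = w₂ - μ₁ • z := by
    rw [hw, hz, eq_sub_of_add_eq' hμ]; module
  -- The comparison state lies exactly on the segment, and equals w₁ on O₁ and w₂ on O₂; this one
  -- estimate therefore serves all three closeness claims.
  have key : ∀ x, ‖w + w' x - (w + (h₀ (N * inner ℝ η x) * χ.1 x) • z)‖ < ε := by
    intro x
    have e : w + w' x - (w + (h₀ (N * inner ℝ η x) * χ.1 x) • z) =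
        (w' x - (h (N * inner ℝ η x) * χ.1 x) • z) +
          ((h (N * inner ℝ η x) - h₀ (N * inner ℝ η x)) * χ.1 x) • z := by module
    rw [e]
    refine (norm_add_le _ _).trans_lt ?_
    have b1 := hclose x
    have b2 : ‖((h (N * inner ℝ η x) - h₀ (N * inner ℝ η x)) * χ.1 x) • z‖ ≤ δ * ‖z‖ := by
      rw [norm_smul, Real.norm_eq_abs, abs_mul, abs_of_nonneg (hχ01 x).1]
      refine mul_le_mul_of_nonneg_right ?_ (norm_nonneg _)
      have := mul_le_mul (hhh₀ (N * inner ℝ η x)) (hχ01 x).2 (hχ01 x).1 hδ.le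
      linarith
    linarith
  have hfsupp : ∀ x, f.1 x ≠ 0 → x ∈ O ∧ χ.1 x = 1 := fun x hx =>
    ⟨hfO (subset_tsupport _ hx), hχf x (subset_tsupport _ hx)⟩
  have hsubO : ∀ a : ℝ → ℝ, {x | a (N * inner ℝ η x) * f.1 x ≠ 0} ⊆ O := fun a x hx =>
    (hfsupp x (right_ne_zero_of_mul hx)).1
  have hfge : v - δ ≤ ∫ x, f.1 x :=
    hKv.trans (le_integral_of_eq_one_on hfc (fun x => (hf01 x).1) hK hfK)
  have low₁ : μ₁ * v - ε < _ := volume_support_gt ha₁ ha₁01 hfc hf01 hO hOfin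
    (fun x hx => (hfsupp x hx).1) hfge hδv ha₁int hC₁N (hC₁ N hN0)
  have low₂ : μ₂ * v - ε < _ := volume_support_gt ha₂ ha₂01 hfc hf01 hO hOfin
    (fun x hx => (hfsupp x hx).1) hfge hδv ha₂int hC₂N (hC₂ N hN0)
  set O₁ := {x | a₁ (N * inner ℝ η x) * f.1 x ≠ 0}
  set O₂ := {x | a₂ (N * inner ℝ η x) * f.1 x ≠ 0}
  have hval₁ : ∀ x ∈ O₁, w + (h₀ (N * inner ℝ η x) * χ.1 x) • z = w₁ := fun x hx => by
    rw [ha₁h _ (left_ne_zero_of_mul hx), (hfsupp x (right_ne_zero_of_mul hx)).2, hw1]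
    module
  have hval₂ : ∀ x ∈ O₂, w + (h₀ (N * inner ℝ η x) * χ.1 x) • z = w₂ := fun x hx => by
    rw [ha₂h _ (left_ne_zero_of_mul hx), (hfsupp x (right_ne_zero_of_mul hx)).2, hw2]
    module
  have hdisj : Disjoint O₁ O₂ := by
    rw [Set.disjoint_left]
    intro x hx₁ hx₂
    have e₁ := ha₁h _ (left_ne_zero_of_mul hx₁)
    have e₂ := ha₂h _ (left_ne_zero_of_mul hx₂)
    linarith
  have hsum : volume.real O₁ + volume.real O₂ ≤ v := by
    have hfin₁ := ((measure_mono (hsubO a₁)).trans_lt hOfin).ne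
    have hfin₂ := ((measure_mono (hsubO a₂)).trans_lt hOfin).ne
    rw [← measureReal_union hdisj (isOpen_support_planeWave η ha₂ f N).measurableSet hfin₁ hfin₂]
    exact measureReal_mono (Set.union_subset (hsubO a₁) (hsubO a₂)) hOfin.ne
  have hμv : μ₁ * v + μ₂ * v = v := by rw [← add_mul, hμ, one_mul]
  refine ⟨w', hw's, hχc.of_isClosed_subset (isClosed_tsupport _) hw'supp, hw'supp.trans hχO, ?_,
    hdiv, hdivM, fun x _ => ?_, O₁, O₂, isOpen_support_planeWave η ha₁ f N,
    isOpen_support_planeWave η ha₂ f N, hsubO a₁, hsubO a₂, hdisj,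
    fun x hx => ?_, fun x hx => ?_, ?_, ?_⟩
  · rw [setIntegral_eq_integral_of_forall_compl_eq_zero, hw'int]
    exact fun x hx => image_eq_zero_of_notMem_tsupport fun h => hx (hχO (hw'supp h))
  · set t := h₀ (N * inner ℝ η x) * χ.1 x with ht
    have hmem : w + t • z ∈ segment ℝ w₁ w₂ := by
      rw [hw]
      exact add_smul_sub_mem_segment hμ (mul_mem_Icc_neg hμ₁ hμ₂ (hh₀ _) (hχ01 x))
    refine (Metric.infDist_le_dist_of_mem hmem).trans_lt ?_
    rw [dist_eq_norm]
    exact key x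
  · have := key x
    rwa [hval₁ x hx] at this
  · have := key x
    rwa [hval₂ x hx] at this
  -- The upper bound comes from the other set: |O₁| ≤ |O| - |O₂| < |O| - μ₂|O| + ε = μ₁|O| + ε.
  · rw [abs_lt]; constructor <;> linarith
  · rw [abs_lt]; constructor <;> linarith
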